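/- Let $\mathbb{T}=\mathbb{R}/2\pi\mathbb{Z}$, $c_*=\frac{\pi}{2\sqrt2}$, and let $\eta_*$ be the $2\pi$-periodic extension of $$\eta_*(x)=\tfrac1{16}\left(\pi^2-4\pi|x|+2x^2\right),\qquad x\in[-\pi,\pi].$$ In the complex Hilbert space $L^2(\mathbb{T})$ consider the unbounded operator $$A_0 f=(c_*^2-2\eta_*)f'-\frac1\pi\oint\eta_*'(x)f(x)\,dx,\qquad \mathcal{D}=\{f\in L^2(\mathbb{T}):\ (c_*^2-2\eta_*)f'\in L^2(\mathbb{T})\},$$ where $f'$ is the weak derivative of $f$ on $\mathbb{T}\setminus\{0\}$, i.e. on $(0,2\pi)$ (the coefficient $c_*^2-2\eta_*$ is positive there and vanishes at $x=0$), $\oint$ is the integral over one period, and the second term is a constant function. The resolvent set $\rho(A_0)$ consists of all $\lambda\in\mathbb{C}$ for which $A_0-\lambda:\mathcal{D}\to L^2(\mathbb{T})$ is bijective with a bounded inverse, and $\sigma(A_0)=\mathbb{C}\setminus\rho(A_0)$. Then $$\sigma(A_0)=\left\{\lambda\in\mathbb{C}:\ -\frac{\pi}{4}\le\operatorname{Re}\lambda\le\frac{\pi}{4}\right\}.$$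 -/

import Mathlib

open MeasureTheory Set
open scoped ContDiff Real

noncomputable section

/-! ### Resolvent set and spectrum of an unbounded operator -/

section Spectrum

variable {E : Type*} [NormedAddCommGroup E] [NormedSpace ℂ E]

/-- The resolvent set of an unbounded operator `T : T.domain ⊂ E → E`: the set of all `μ ∈ ℂ` for
which `T - μ : T.domain → E` is a bijection whose inverse is a bounded operator on `E`. -/
def unboundedResolventSet (T : E →ₗ.[ℂ] E) : Set ℂ :=
  {μ | ∃ R : E →L[ℂ] E,
    (∀ y : E, ∃ hy : R y ∈ T.domain, T ⟨R y, hy⟩ - μ • R y = y) ∧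
    (∀ x : T.domain, R (T x - μ • (x : E)) = x)}

/-- The spectrum of an unbounded operator: the complement of its resolvent set. -/
def unboundedSpectrum (T : E →ₗ.[ℂ] E) : Set ℂ :=
  (unboundedResolventSet T)ᶜ

end Spectrum

/-! ### Weak derivatives -/

/-- `u` is the weak derivative of `f` on the open set `U ⊆ ℝ`. -/
def HasWeakDerivOn (f u : ℝ → ℂ) (U : Set ℝ) : Prop :=
  LocallyIntegrableOn f U ∧ LocallyIntegrableOn u U ∧
    ∀ ψ : ℝ → ℝ, ContDiff ℝ ∞ ψ → HasCompactSupport ψ → tsupport ψ ⊆ U →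
      ∫ x, deriv ψ x • f x = - ∫ x, ψ x • u x

lemma integrable_test_smul {u : ℝ → ℂ} {U : Set ℝ}
    (hu : LocallyIntegrableOn u U) {ψ : ℝ → ℝ} (hψ : Continuous ψ)
    (hc : HasCompactSupport ψ) (hs : tsupport ψ ⊆ U) : Integrable (fun x => ψ x • u x) := by
  have h1 : IntegrableOn u (tsupport ψ) := hu.integrableOn_compact_subset hs hc
  have h2 : IntegrableOn (fun x => ψ x • u x) (tsupport ψ) :=
    h1.continuousOn_smul hψ.continuousOn hc
  refine (integrableOn_iff_integrable_of_support_subset ?_).1 h2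
  intro x hx
  apply subset_tsupport
  intro h0
  apply hx
  simp [h0]

lemma HasWeakDerivOn.add {f₁ f₂ u₁ u₂ : ℝ → ℂ} {U : Set ℝ}
    (h₁ : HasWeakDerivOn f₁ u₁ U) (h₂ : HasWeakDerivOn f₂ u₂ U) :
    HasWeakDerivOn (fun x => f₁ x + f₂ x) (fun x => u₁ x + u₂ x) U := by
  refine ⟨h₁.1.add h₂.1, h₁.2.1.add h₂.2.1, fun ψ hψ hc hs => ?_⟩
  have hd : Continuous (deriv ψ) := hψ.continuous_deriv (by simp)
  have hds : tsupport (deriv ψ) ⊆ U := (tsupport_deriv_subset (f := ψ)).trans hs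
  simp only [smul_add]
  rw [integral_add (integrable_test_smul h₁.1 hd hc.deriv hds)
      (integrable_test_smul h₂.1 hd hc.deriv hds),
    integral_add (integrable_test_smul h₁.2.1 hψ.continuous hc hs)
      (integrable_test_smul h₂.2.1 hψ.continuous hc hs),
    h₁.2.2 ψ hψ hc hs, h₂.2.2 ψ hψ hc hs, neg_add]

lemma HasWeakDerivOn.const_smul {f u : ℝ → ℂ} {U : Set ℝ}
    (h : HasWeakDerivOn f u U) (c : ℂ) :
    HasWeakDerivOn (fun x => c • f x) (fun x => c • u x) U := by
  refine ⟨h.1.smul c, h.2.1.smul c, fun ψ hψ hc hs => ?_⟩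
  simp only [smul_comm _ c]
  rw [integral_smul, integral_smul, h.2.2 ψ hψ hc hs, smul_neg]

lemma HasWeakDerivOn.congr {f g u : ℝ → ℂ} {U : Set ℝ} (hU : IsOpen U)
    (h : HasWeakDerivOn f u U) (hfg : f =ᵐ[volume.restrict U] g) :
    HasWeakDerivOn g u U := by
  have hfg' := (ae_restrict_iff' hU.measurableSet).1 hfg
  refine ⟨(locallyIntegrableOn_iff hU.isLocallyClosed).2 fun k hk hkc => ?_, h.2.1,
    fun ψ hψ hc hs => ?_⟩
  · exact (h.1.integrableOn_compact_subset hk hkc).congr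
      (ae_mono (Measure.restrict_mono hk le_rfl) hfg)
  · rw [← h.2.2 ψ hψ hc hs]
    refine integral_congr_ae ?_
    filter_upwards [hfg'] with x hx
    by_cases hxU : x ∈ U
    · simp only [hx hxU]
    · have : deriv ψ x = 0 :=
        image_eq_zero_of_notMem_tsupport fun h' => hxU (hs (tsupport_deriv_subset h'))
      simp [this]

lemma HasWeakDerivOn.unique {f u v : ℝ → ℂ} {U : Set ℝ} (hU : IsOpen U)
    (h₁ : HasWeakDerivOn f u U) (h₂ : HasWeakDerivOn f v U) :
    ∀ᵐ x, x ∈ U → u x = v x := by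
  have key := hU.ae_eq_zero_of_integral_contDiff_smul_eq_zero (h₁.2.1.sub h₂.2.1) ?_
  · filter_upwards [key] with x hx hxU
    exact sub_eq_zero.1 (hx hxU)
  · intro ψ hψ hc hs
    simp only [Pi.sub_apply, smul_sub]
    rw [integral_sub (integrable_test_smul h₁.2.1 hψ.continuous hc hs)
      (integrable_test_smul h₂.2.1 hψ.continuous hc hs), sub_eq_zero]
    exact neg_injective ((h₁.2.2 ψ hψ hc hs).symm.trans (h₂.2.2 ψ hψ hc hs))

/-! ### The peaked wave and the truncated linearized operator on the circle -/

namespace PeakedWave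

instance factTwoPiPos : Fact (0 < 2 * π) := ⟨Real.two_pi_pos⟩

/-- The circle `𝕋 = ℝ / 2πℤ`; its `volume` has total mass `2π`. -/
abbrev Torus : Type := AddCircle (2 * π)

/-- The complex Hilbert space `L²(𝕋)`. -/
abbrev L2 : Type := Lp ℂ 2 (volume : Measure Torus)

/-- The speed `c_* = π / (2√2)` of the peaked wave. -/
def cStar : ℝ := π / (2 * √2)

/-- The peaked profile: `η_*(x) = (π² - 4π|x| + 2x²) / 16` for `x ∈ [-π, π]`, extended
`2π`-periodically. -/
def etaStar : Torus → ℝ :=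
  AddCircle.liftIoc (2 * π) (-π) fun x : ℝ => (π ^ 2 - 4 * π * |x| + 2 * x ^ 2) / 16

/-- The slope `η_*'`, as a function of the coordinate `x ∈ ℝ` (it is `0`, by convention, at the
peaks `x ∈ 2πℤ`, a null set). -/
def etaStarSlope (x : ℝ) : ℝ := deriv (fun y : ℝ => etaStar (y : Torus)) x

lemma etaStar_coe {x : ℝ} (hx : x ∈ Ioo 0 (2 * π)) :
    etaStar (x : Torus) = (π ^ 2 - 4 * π * x + 2 * x ^ 2) / 16 := by
  unfold etaStar
  rcases le_or_gt x π with h | h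
  · rw [AddCircle.liftIoc_coe_apply ⟨by linarith [hx.1, Real.pi_pos], by linarith⟩,
      abs_of_pos hx.1]
  · have h2 : ((x - 2 * π : ℝ) : Torus) = (x : Torus) := by
      simp [AddCircle.coe_period]
    rw [← h2, AddCircle.liftIoc_coe_apply ⟨by linarith, by linarith [hx.2, Real.pi_pos]⟩,
      abs_of_neg (by linarith [hx.2])]
    ring

lemma etaStarSlope_eq {x : ℝ} (hx : x ∈ Ioo 0 (2 * π)) : etaStarSlope x = (x - π) / 4 := by
  have h : (fun y : ℝ => etaStar (y : Torus)) =ᶠ[nhds x]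
      fun y => (π ^ 2 - 4 * π * y + 2 * y ^ 2) / 16 := by
    filter_upwards [isOpen_Ioo.mem_nhds hx] with y hy using etaStar_coe hy
  have h2 : HasDerivAt (fun y : ℝ => (π ^ 2 - 4 * π * y + 2 * y ^ 2) / 16) ((x - π) / 4) x := by
    have h3 := (((hasDerivAt_const x (π ^ 2)).fun_sub ((hasDerivAt_id' x).const_mul (4 * π))).fun_add
      (((hasDerivAt_id' x).fun_pow 2).const_mul 2)).div_const 16
    refine h3.congr_deriv ?_
    norm_num
    ring
  rw [etaStarSlope, h.deriv_eq, h2.deriv]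

lemma ae_coe {p : Torus → Prop} (h : ∀ᵐ t, p t) :
    ∀ᵐ x : ℝ ∂volume.restrict (Ioo 0 (2 * π)), p (x : Torus) := by
  have h1 := (AddCircle.measurePreserving_mk (2 * π) 0).quasiMeasurePreserving.ae h
  rw [zero_add] at h1
  exact ae_mono (Measure.restrict_mono Ioo_subset_Ioc_self le_rfl) h1

lemma ae_of_ae_coe {p : Torus → Prop} (hp : NullMeasurableSet {t | p t})
    (h : ∀ᵐ x : ℝ ∂volume.restrict (Ioo 0 (2 * π)), p (x : Torus)) : ∀ᵐ t, p t := by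
  have h0 := AddCircle.measurePreserving_mk (2 * π) 0
  rw [zero_add] at h0
  rw [← Measure.restrict_congr_set Ioo_ae_eq_Ioc] at h0
  rw [ae_iff, ← compl_ofPred, ← h0.measure_preimage hp.compl]
  exact h

/-- `g = (c_*² - 2η_*) f'` in `L²(𝕋)`, where `f'` is the weak derivative of `f` on the interval
`(0, 2π)` between two consecutive peaks, i.e. on `𝕋 ∖ {0}`. Nothing is lost at the peak `x = 0`:
the coefficient `c_*² - 2η_*` vanishes there, so a jump of `f` at `0` does not contribute to
`(c_*² - 2η_*) f'`. -/
def IsWeightedDeriv (f g : L2) : Prop :=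
  ∃ u : ℝ → ℂ, HasWeakDerivOn (fun x => f (x : Torus)) u (Ioo 0 (2 * π)) ∧
    ∀ᵐ x : ℝ ∂volume.restrict (Ioo 0 (2 * π)),
      g (x : Torus) = ((cStar ^ 2 - 2 * etaStar (x : Torus) : ℝ) : ℂ) * u x

lemma IsWeightedDeriv.add {f₁ f₂ g₁ g₂ : L2} (h₁ : IsWeightedDeriv f₁ g₁)
    (h₂ : IsWeightedDeriv f₂ g₂) : IsWeightedDeriv (f₁ + f₂) (g₁ + g₂) := by
  obtain ⟨u₁, hu₁, e₁⟩ := h₁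
  obtain ⟨u₂, hu₂, e₂⟩ := h₂
  refine ⟨fun x => u₁ x + u₂ x, (hu₁.add hu₂).congr isOpen_Ioo ?_, ?_⟩
  · filter_upwards [ae_coe (Lp.coeFn_add f₁ f₂)] with x hx
    exact hx.symm
  · filter_upwards [ae_coe (Lp.coeFn_add g₁ g₂), e₁, e₂] with x hx h1 h2
    rw [hx, Pi.add_apply, h1, h2, mul_add]

lemma IsWeightedDeriv.smul {f g : L2} (h : IsWeightedDeriv f g) (c : ℂ) :
    IsWeightedDeriv (c • f) (c • g) := by
  obtain ⟨u, hu, e⟩ := h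
  refine ⟨fun x => c • u x, (hu.const_smul c).congr isOpen_Ioo ?_, ?_⟩
  · filter_upwards [ae_coe (Lp.coeFn_smul c f)] with x hx
    exact hx.symm
  · filter_upwards [ae_coe (Lp.coeFn_smul c g), e] with x hx h1
    rw [hx, Pi.smul_apply, h1, smul_eq_mul, smul_eq_mul]
    ring

lemma IsWeightedDeriv.unique {f g₁ g₂ : L2} (h₁ : IsWeightedDeriv f g₁)
    (h₂ : IsWeightedDeriv f g₂) : g₁ = g₂ := by
  obtain ⟨u₁, hu₁, e₁⟩ := h₁
  obtain ⟨u₂, hu₂, e₂⟩ := h₂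
  have hu := (ae_restrict_iff' measurableSet_Ioo).2 (hu₁.unique isOpen_Ioo hu₂)
  refine Lp.ext (ae_of_ae_coe ?_ ?_)
  · exact nullMeasurableSet_eq_fun (Lp.aestronglyMeasurable g₁).aemeasurable
      (Lp.aestronglyMeasurable g₂).aemeasurable
  · filter_upwards [hu, e₁, e₂] with x hx h1 h2
    rw [h1, h2, hx]

lemma IsWeightedDeriv.zero : IsWeightedDeriv 0 0 := by
  have h0 : (fun x : ℝ => (0 : ℂ)) =ᵐ[volume.restrict (Ioo 0 (2 * π))]
      fun x : ℝ => (0 : L2) (x : Torus) := by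
    filter_upwards [ae_coe (Lp.coeFn_zero ℂ 2 (volume : Measure Torus))] with x hx
    exact hx.symm
  refine ⟨fun _ => 0, HasWeakDerivOn.congr isOpen_Ioo ?_ h0, ?_⟩
  · exact ⟨locallyIntegrableOn_zero, locallyIntegrableOn_zero, by simp⟩
  · filter_upwards [h0] with x hx
    rw [← hx, mul_zero]

/-- The operator `f ↦ (c_*² - 2η_*) f'` in `L²(𝕋)` with the domain
`𝒟 = {f ∈ L²(𝕋) : (c_*² - 2η_*) f' ∈ L²(𝕋)}`. -/
def weightedDeriv : L2 →ₗ.[ℂ] L2 where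
  domain :=
    { carrier := {f | ∃ g : L2, IsWeightedDeriv f g}
      add_mem' := fun ⟨g₁, h₁⟩ ⟨g₂, h₂⟩ => ⟨g₁ + g₂, h₁.add h₂⟩
      zero_mem' := ⟨0, IsWeightedDeriv.zero⟩
      smul_mem' := fun c _ ⟨g, h⟩ => ⟨c • g, h.smul c⟩ }
  toFun :=
    { toFun := fun f => Classical.choose f.2
      map_add' := fun f₁ f₂ => (Classical.choose_spec (f₁ + f₂).2).unique
        ((Classical.choose_spec f₁.2).add (Classical.choose_spec f₂.2))
      map_smul' := fun c f => (Classical.choose_spec (c • f).2).unique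
        ((Classical.choose_spec f.2).smul c) }

lemma weightedDeriv_spec (f : weightedDeriv.domain) :
    IsWeightedDeriv (f : L2) (weightedDeriv f) :=
  Classical.choose_spec f.2

lemma integrableOn_slope_mul (f : L2) :
    IntegrableOn (fun x : ℝ => (etaStarSlope x : ℂ) * f (x : Torus)) (Ioo 0 (2 * π)) := by
  have h0 := AddCircle.measurePreserving_mk (2 * π) 0
  rw [zero_add] at h0
  rw [← Measure.restrict_congr_set Ioo_ae_eq_Ioc] at h0
  have hf : Integrable (fun x : ℝ => f (x : Torus)) (volume.restrict (Ioo 0 (2 * π))) :=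
    h0.integrable_comp_of_integrable ((Lp.memLp f).integrable (by norm_num))
  refine hf.bdd_mul (c := π / 4) ?_ ?_
  · exact (Complex.measurable_ofReal.comp (measurable_deriv _)).aestronglyMeasurable
  · filter_upwards [ae_restrict_mem measurableSet_Ioo] with x hx
    rw [etaStarSlope_eq hx, Complex.norm_real, Real.norm_eq_abs, abs_le]
    constructor <;> linarith [hx.1, hx.2]

/-- The linear functional `f ↦ ∮ η_*' f dx` on `L²(𝕋)`. -/
def slopeIntegral : L2 →ₗ[ℂ] ℂ where
  toFun f := ∫ x in Ioo 0 (2 * π), (etaStarSlope x : ℂ) * f (x : Torus)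
  map_add' f g := by
    rw [← integral_add (integrableOn_slope_mul f) (integrableOn_slope_mul g)]
    refine integral_congr_ae ?_
    filter_upwards [ae_coe (Lp.coeFn_add f g)] with x hx
    rw [hx, Pi.add_apply, mul_add]
  map_smul' c f := by
    rw [RingHom.id_apply, ← integral_smul]
    refine integral_congr_ae ?_
    filter_upwards [ae_coe (Lp.coeFn_smul c f)] with x hx
    rw [hx, Pi.smul_apply, smul_eq_mul, smul_eq_mul]
    ring

/-- The truncated operator `A₀ f = (c_*² - 2η_*) f' - (1/π) ∮ η_*' f dx` in `L²(𝕋)` with the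
domain `𝒟`; the second term is a constant function. -/
def truncatedOperator : L2 →ₗ.[ℂ] L2 where
  domain := weightedDeriv.domain
  toFun := weightedDeriv.toFun -
    ((1 / π : ℝ) : ℂ) • ((Lp.constₗ 2 (volume : Measure Torus) ℂ).comp slopeIntegral).comp
      weightedDeriv.domain.subtype

end PeakedWave

end

/-! On `(0, 2π)` the coefficient `c_*² - 2η_*` equals `w = x (2π - x) / 4`. In the coordinate `s =
(2/π) log (x / (2π - x))`, for which `ds = dx / w`, the differential part `w d/dx` becomes `d/ds` on
the whole line, and `L²(dx)` becomes `L²(w ds)`, whose weight decays like `exp (-π|s|/2)`. The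
solutions `exp (μ s)` of `w f' = μ f` are therefore square integrable exactly when `|Re μ| < π/4`.

For `0 < Re μ < π/4` this gives eigenfunctions (`memLp_flowExp`, `exists_eigenvector`). For `Re μ >
π/4` the kernel is trivial (`eq_zero_of_isWeightedDeriv_smul`), and variation of constants from the
endpoint `2π` solves `w f' = μ f + g` with norm at most `1 / (Re μ - π/4)`
(`exists_isWeightedDeriv_smul_add`). The bound is a Schur test: `√w exp (π s / 4) = x / 2` is
increasing, so the kernel is dominated by an exponential convolution kernel in `s`.

The rank-one term is harmless for `μ ≠ 0`. It takes values in the constants, which are annihilated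
both by `w d/dx` and by the functional `∮ η_*' f`, because `η_*'` has mean zero. Subtracting the
constant `c / μ`, `c = (1/π) ∮ η_*' f`, from a solution without this term gives a solution with it.

The reflection `x ↦ -x` anticommutes with the operator and transfers everything to `Re μ ≤ 0`. The
lines `Re μ = 0` and `Re μ = ±π/4` follow because the spectrum contains the closure of the set of
eigenvalues. -/

noncomputable section

/-! ### Calculus of weak derivatives on an interval -/

lemma contDiff_smul_of_tsupport_subset {ψ : ℝ → ℝ} {θ : ℝ → ℂ} {U : Set ℝ} (hU : IsOpen U)
    (hψ : ContDiff ℝ ∞ ψ) (hs : tsupport ψ ⊆ U) (hθ : ContDiffOn ℝ ∞ θ U) :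
    ContDiff ℝ ∞ fun x => ψ x • θ x := by
  rw [contDiff_iff_contDiffAt]
  intro x
  by_cases hx : x ∈ tsupport ψ
  · exact hψ.contDiffAt.smul (hθ.contDiffAt (hU.mem_nhds (hs hx)))
  · refine (contDiffAt_const (c := (0 : ℂ))).congr_of_eventuallyEq ?_
    filter_upwards [(isClosed_tsupport ψ).isOpen_compl.mem_nhds hx] with y hy
    rw [image_eq_zero_of_notMem_tsupport hy, zero_smul]

lemma integral_re_test_add_im_test {u : ℝ → ℂ} {U : Set ℝ} (hu : LocallyIntegrableOn u U)
    {Ψ : ℝ → ℂ} (hΨ : Continuous Ψ) (hc : HasCompactSupport Ψ) (hs : tsupport Ψ ⊆ U) :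
    ∫ x, Ψ x * u x = (∫ x, (Ψ x).re • u x) + Complex.I * ∫ x, (Ψ x).im • u x := by
  have hre : HasCompactSupport fun x => (Ψ x).re := hc.comp_left (g := Complex.re) rfl
  have him : HasCompactSupport fun x => (Ψ x).im := hc.comp_left (g := Complex.im) rfl
  have sre : tsupport (fun x => (Ψ x).re) ⊆ U :=
    (closure_mono (Function.support_comp_subset (g := Complex.re) rfl Ψ)).trans hs
  have sim : tsupport (fun x => (Ψ x).im) ⊆ U :=
    (closure_mono (Function.support_comp_subset (g := Complex.im) rfl Ψ)).trans hs
  have ire : Integrable fun x => (Ψ x).re • u x :=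
    integrable_test_smul hu (Complex.continuous_re.comp hΨ) hre sre
  have iim : Integrable fun x => (Ψ x).im • u x :=
    integrable_test_smul hu (Complex.continuous_im.comp hΨ) him sim
  rw [← integral_const_mul, ← integral_add ire (iim.const_mul _)]
  refine integral_congr_ae (.of_forall fun x => ?_)
  simp only [Complex.real_smul]
  nth_rewrite 1 [← Complex.re_add_im (Ψ x)]
  ring

/-- Real and imaginary parts of a complex test function are real test functions. The complex version
is needed for the product rule, where the test function is multiplied by a complex factor such as
`flowExp μ`. -/
lemma HasWeakDerivOn.integral_deriv_mul {f u : ℝ → ℂ} {U : Set ℝ} (h : HasWeakDerivOn f u U)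
    {Ψ : ℝ → ℂ} (hΨ : ContDiff ℝ ∞ Ψ) (hc : HasCompactSupport Ψ) (hs : tsupport Ψ ⊆ U) :
    ∫ x, deriv Ψ x * f x = - ∫ x, Ψ x * u x := by
  have hre : HasCompactSupport fun x => (Ψ x).re := hc.comp_left (g := Complex.re) rfl
  have him : HasCompactSupport fun x => (Ψ x).im := hc.comp_left (g := Complex.im) rfl
  have sre : tsupport (fun x => (Ψ x).re) ⊆ U :=
    (closure_mono (Function.support_comp_subset (g := Complex.re) rfl Ψ)).trans hs
  have sim : tsupport (fun x => (Ψ x).im) ⊆ U :=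
    (closure_mono (Function.support_comp_subset (g := Complex.im) rfl Ψ)).trans hs
  have hd : ∀ x, HasDerivAt Ψ (deriv Ψ x) x :=
    fun x => (hΨ.differentiable (by simp) x).hasDerivAt
  have dre : deriv (fun x => (Ψ x).re) = fun x => (deriv Ψ x).re :=
    funext fun x => (Complex.reCLM.hasFDerivAt.comp_hasDerivAt x (hd x)).deriv
  have dim : deriv (fun x => (Ψ x).im) = fun x => (deriv Ψ x).im :=
    funext fun x => (Complex.imCLM.hasFDerivAt.comp_hasDerivAt x (hd x)).deriv
  have e1 := h.2.2 _ (Complex.reCLM.contDiff.comp hΨ) hre sre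
  have e2 := h.2.2 _ (Complex.imCLM.contDiff.comp hΨ) him sim
  simp only [Function.comp_def, Complex.reCLM_apply, Complex.imCLM_apply] at e1 e2
  rw [dre] at e1
  rw [dim] at e2
  rw [integral_re_test_add_im_test h.1 (hΨ.continuous_deriv (by simp)) hc.deriv
    ((tsupport_deriv_subset (f := Ψ)).trans hs), integral_re_test_add_im_test h.2.1 hΨ.continuous
    hc hs, e1, e2]
  ring

lemma HasWeakDerivOn.congr_deriv {f u v : ℝ → ℂ} {U : Set ℝ} (hU : IsOpen U)
    (h : HasWeakDerivOn f u U) (huv : u =ᵐ[volume.restrict U] v) : HasWeakDerivOn f v U := by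
  refine ⟨h.1, (locallyIntegrableOn_iff hU.isLocallyClosed).2 fun k hk hkc =>
    (h.2.1.integrableOn_compact_subset hk hkc).congr
      (ae_mono (Measure.restrict_mono hk le_rfl) huv), fun ψ hψ hc hs => ?_⟩
  rw [h.2.2 ψ hψ hc hs]
  congr 1
  refine integral_congr_ae ?_
  filter_upwards [(ae_restrict_iff' hU.measurableSet).1 huv] with x hx
  by_cases hxU : x ∈ U
  · simp only [hx hxU]
  · simp [image_eq_zero_of_notMem_tsupport fun h' => hxU (hs h')]

/-- The product rule for a weak derivative and a smooth function. -/
lemma HasWeakDerivOn.contDiffOn_mul {f u θ : ℝ → ℂ} {U : Set ℝ} (hU : IsOpen U)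
    (h : HasWeakDerivOn f u U) (hθ : ContDiffOn ℝ ∞ θ U) :
    HasWeakDerivOn (fun x => θ x * f x) (fun x => θ x * u x + deriv θ x * f x) U := by
  have hθ' : ContinuousOn (deriv θ) U := hθ.continuousOn_deriv_of_isOpen hU (by simp)
  have i1 : LocallyIntegrableOn (fun x => θ x * u x) U :=
    h.2.1.continuousOn_mul hθ.continuousOn hU.isLocallyClosed
  have i2 : LocallyIntegrableOn (fun x => deriv θ x * f x) U :=
    h.1.continuousOn_mul hθ' hU.isLocallyClosed
  have i3 : LocallyIntegrableOn (fun x => θ x * f x) U :=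
    h.1.continuousOn_mul hθ.continuousOn hU.isLocallyClosed
  refine ⟨i3, i1.add i2, fun ψ hψ hc hs => ?_⟩
  have hc' : HasCompactSupport fun x => ψ x • θ x := hc.smul_right
  have hsub : tsupport (fun x => ψ x • θ x) ⊆ tsupport ψ :=
    closure_mono (Function.support_smul_subset_left ψ θ)
  have key := h.integral_deriv_mul (contDiff_smul_of_tsupport_subset hU hψ hs hθ) hc'
    (hsub.trans hs)
  have hd : ∀ x, deriv (fun x => ψ x • θ x) x * f x
      = deriv ψ x • (θ x * f x) + ψ x • (deriv θ x * f x) := by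
    intro x
    by_cases hx : x ∈ tsupport ψ
    · have h1 : HasDerivAt θ (deriv θ x) x :=
        ((hθ.contDiffAt (hU.mem_nhds (hs hx))).differentiableAt (by simp)).hasDerivAt
      have h2 : HasDerivAt ψ (deriv ψ x) x := (hψ.differentiable (by simp) x).hasDerivAt
      rw [(h2.fun_smul h1).deriv]
      simp only [Complex.real_smul]
      ring
    · have h0 : deriv (fun x => ψ x • θ x) x = 0 := by
        refine image_eq_zero_of_notMem_tsupport fun h' => hx ?_
        exact hsub (tsupport_deriv_subset (f := fun x => ψ x • θ x) h')
      rw [h0, image_eq_zero_of_notMem_tsupport hx,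
        image_eq_zero_of_notMem_tsupport fun h' => hx (tsupport_deriv_subset (f := ψ) h')]
      simp
  simp only [hd] at key
  rw [integral_add (integrable_test_smul i3 (hψ.continuous_deriv (by simp)) hc.deriv
    ((tsupport_deriv_subset (f := ψ)).trans hs))
    (integrable_test_smul i2 hψ.continuous hc hs)] at key
  simp only [smul_add]
  rw [integral_add (integrable_test_smul i1 hψ.continuous hc hs)
    (integrable_test_smul i2 hψ.continuous hc hs), neg_add]
  simp only [smul_mul_assoc] at key
  rw [← key]
  ring

lemma hasWeakDerivOn_const (c : ℂ) (U : Set ℝ) :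
    HasWeakDerivOn (fun _ => c) (fun _ => 0) U := by
  refine ⟨(locallyIntegrable_const c).locallyIntegrableOn _, locallyIntegrableOn_zero,
    fun ψ hψ hc _ => ?_⟩
  have h0 : ∫ x, deriv ψ x = 0 := integral_eq_zero_of_hasDerivAt_of_integrable
    (fun x => (hψ.differentiable (by simp) x).hasDerivAt)
    ((hψ.continuous_deriv (by simp)).integrable_of_hasCompactSupport hc.deriv)
    (hψ.continuous.integrable_of_hasCompactSupport hc)
  rw [integral_smul_const, h0]
  simp

lemma exists_subset_Icc_of_isCompact_subset_Ioo {a b : ℝ} (hab : a < b) {K : Set ℝ}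
    (hK : IsCompact K) (hs : K ⊆ Ioo a b) : ∃ α β, a < α ∧ α ≤ β ∧ β < b ∧ K ⊆ Icc α β := by
  rcases K.eq_empty_or_nonempty with rfl | hne
  · exact ⟨(a + b) / 2, (a + b) / 2, by linarith, le_rfl, by linarith, empty_subset _⟩
  · obtain ⟨α, hα⟩ := hK.exists_isLeast hne
    obtain ⟨β, hβ⟩ := hK.exists_isGreatest hne
    exact ⟨α, β, (hs hα.1).1, hα.2 hβ.1, (hs hβ.1).2, fun x hx => ⟨hα.2 hx, hβ.2 hx⟩⟩

/-- The primitive from the left end of the support vanishes to the left of the support, and to the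
right of it because the mean of `χ` is zero. -/
lemma exists_test_primitive {a b : ℝ} (hab : a < b) {χ : ℝ → ℝ} (hχ : ContDiff ℝ ∞ χ)
    (hc : HasCompactSupport χ) (hs : tsupport χ ⊆ Ioo a b) (h0 : ∫ x, χ x = 0) :
    ∃ Ψ : ℝ → ℝ, ContDiff ℝ ∞ Ψ ∧ HasCompactSupport Ψ ∧ tsupport Ψ ⊆ Ioo a b ∧
      deriv Ψ = χ := by
  obtain ⟨α, β, hα, hαβ, hβ, hK⟩ := exists_subset_Icc_of_isCompact_subset_Ioo hab hc hs
  have hd : ∀ x, HasDerivAt (fun x => ∫ t in α..x, χ t) (χ x) x := fun x =>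
    intervalIntegral.integral_hasDerivAt_right (hχ.continuous.intervalIntegrable _ _)
      (hχ.continuous.stronglyMeasurableAtFilter _ _) hχ.continuous.continuousAt
  have hder : deriv (fun x => ∫ t in α..x, χ t) = χ := funext fun x => (hd x).deriv
  have hz : ∀ x, x ∉ Icc α β → χ x = 0 := fun x hx =>
    image_eq_zero_of_notMem_tsupport fun h => hx (hK h)
  have hsupp : Function.support (fun x => ∫ t in α..x, χ t) ⊆ Icc α β := by
    intro x hx
    by_contra hx'
    apply hx
    rcases lt_or_ge x α with h | h
    · refine (intervalIntegral.integral_congr_ae (g := fun _ => 0) ?_).trans (by simp)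
      rw [uIoc_of_ge h.le]
      -- The half-open interval `(x, α]` contains `α`, where `hz` says nothing; this point is a null
      -- set.
      filter_upwards [(measure_eq_zero_iff_ae_notMem (s := {α})).1 (by simp)] with t ht htx
      exact hz t fun h' => ht (le_antisymm htx.2 h'.1)
    · have hxβ : β < x := by
        by_contra h2
        exact hx' ⟨h, not_lt.1 h2⟩
      change ∫ t in α..x, χ t = 0
      rw [intervalIntegral.integral_of_le h, ← integral_Icc_eq_integral_Ioc,
        setIntegral_eq_integral_of_forall_compl_eq_zero, h0]
      exact fun t ht => hz t fun h' => ht ⟨h'.1, h'.2.trans hxβ.le⟩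
  have hts : tsupport (fun x => ∫ t in α..x, χ t) ⊆ Icc α β :=
    closure_minimal hsupp isClosed_Icc
  refine ⟨_, ?_, HasCompactSupport.of_support_subset_isCompact isCompact_Icc hsupp,
    hts.trans fun x hx => ⟨hα.trans_le hx.1, hx.2.trans_lt hβ⟩, hder⟩
  rw [contDiff_infty_iff_deriv, hder]
  exact ⟨fun x => (hd x).differentiableAt, hχ⟩

/-- A function whose weak derivative vanishes on an interval is constant. -/
lemma HasWeakDerivOn.ae_eq_const {f : ℝ → ℂ} {a b : ℝ} (hab : a < b)
    (h : HasWeakDerivOn f (fun _ => 0) (Ioo a b)) :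
    ∃ c : ℂ, ∀ᵐ x, x ∈ Ioo a b → f x = c := by
  let φ : ContDiffBump ((a + b) / 2) := ⟨(b - a) / 8, (b - a) / 4, by linarith, by linarith⟩
  set ρ : ℝ → ℝ := φ.normed volume with hρ
  have ρs : ContDiff ℝ ∞ ρ := φ.contDiff_normed
  have ρc : HasCompactSupport ρ := φ.hasCompactSupport_normed
  have ρt : tsupport ρ ⊆ Ioo a b := by
    rw [hρ, φ.tsupport_normed_eq, Real.closedBall_eq_Icc]
    intro x hx
    have h1 : φ.rOut = (b - a) / 4 := rfl
    rw [h1] at hx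
    exact ⟨by linarith [hx.1], by linarith [hx.2]⟩
  have ρ1 : ∫ x, ρ x = 1 := φ.integral_normed
  have iρ := integrable_test_smul h.1 ρs.continuous ρc ρt
  refine ⟨∫ x, ρ x • f x, ?_⟩
  have hloc := (locallyIntegrable_const (μ := (volume : Measure ℝ))
    (∫ x, ρ x • f x)).locallyIntegrableOn (Ioo a b)
  have key := isOpen_Ioo.ae_eq_zero_of_integral_contDiff_smul_eq_zero (h.1.sub hloc) ?_
  · filter_upwards [key] with x hx hxU
    exact sub_eq_zero.1 (hx hxU)
  · intro ψ hψ hc hs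
    set I := ∫ x, ψ x with hI
    have iψ : Integrable ψ := hψ.continuous.integrable_of_hasCompactSupport hc
    have iρ' : Integrable ρ := ρs.continuous.integrable_of_hasCompactSupport ρc
    have iψf := integrable_test_smul h.1 hψ.continuous hc hs
    -- As `ρ` has mean one, `ψ - (∫ ψ) ρ` has mean zero and is the derivative of a test function.
    -- Testing `f` against it gives `∫ ψ f = (∫ ψ) (∫ ρ f)`.
    obtain ⟨Ψ, h1, h2, h3, h4⟩ := exists_test_primitive (χ := fun x => ψ x - I * ρ x) hab
      (hψ.sub (contDiff_const.mul ρs)) (hc.sub ρc.mul_left)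
      ((tsupport_sub ψ fun x => I * ρ x).trans (union_subset hs
        ((closure_mono (Function.support_mul_subset_right _ ρ)).trans ρt)))
      (by rw [integral_sub iψ (iρ'.const_mul I), integral_const_mul, ρ1]; simp [hI])
    have h5 := h.2.2 Ψ h1 h2 h3
    rw [h4] at h5
    simp only [sub_smul, mul_smul, smul_zero, integral_zero, neg_zero] at h5
    rw [integral_sub iψf (iρ.fun_smul I), integral_smul] at h5
    simp only [Pi.sub_apply, smul_sub]
    rw [integral_sub iψf (iψ.smul_const _), integral_smul_const, ← hI]
    exact h5

/-- The primitive `x ↦ ∫_x^b m` has the weak derivative `-m`. -/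
lemma hasWeakDerivOn_integral_Ioo {a b : ℝ} (hab : a < b) {m : ℝ → ℂ}
    (hm : ∀ x ∈ Ioo a b, IntegrableOn m (Ioo x b)) :
    HasWeakDerivOn (fun x => ∫ y in Ioo x b, m y) (fun y => - m y) (Ioo a b) := by
  have hU : IsLocallyClosed (Ioo a b) := isOpen_Ioo.isLocallyClosed
  have hsub : ∀ {K : Set ℝ}, IsCompact K → K ⊆ Ioo a b →
      ∃ α ∈ Ioo a b, K ⊆ Ioo α b := fun hK hs => by
    obtain ⟨α, β, h1, h2, h3, h4⟩ := exists_subset_Icc_of_isCompact_subset_Ioo hab hK hs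
    exact ⟨(a + α) / 2, ⟨by linarith, by linarith⟩,
      fun x hx => ⟨by linarith [(h4 hx).1], (h4 hx).2.trans_lt h3⟩⟩
  have hloc : LocallyIntegrableOn m (Ioo a b) := by
    refine (locallyIntegrableOn_iff hU).2 fun K hs hK => ?_
    obtain ⟨α, hα, hKα⟩ := hsub hK hs
    exact (hm α hα).mono_set hKα
  have hcont : ∀ α ∈ Ioo a b, ContinuousOn (fun x => ∫ y in Ioo x b, m y) (Ioo α b) := by
    intro α hα
    have hint : Integrable ((Ioo α b).indicator m) :=
      (hm α hα).integrable_indicator measurableSet_Ioo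
    have h1 : Continuous fun x => (∫ y in Ioi α, (Ioo α b).indicator m y) -
        ∫ y in α..x, (Ioo α b).indicator m y :=
      continuous_const.sub
        (intervalIntegral.continuous_primitive (fun _ _ => hint.intervalIntegrable) α)
    refine h1.continuousOn.congr fun x hx => ?_
    have h2 : ∫ y in Ioo x b, m y = ∫ y in Ioi x, (Ioo α b).indicator m y := by
      rw [setIntegral_indicator measurableSet_Ioo]
      congr 2
      ext y
      simp only [mem_Ioo, mem_inter_iff, mem_Ioi]
      exact ⟨fun h => ⟨h.1, hx.1.trans h.1, h.2⟩, fun h => ⟨h.1, h.2.2⟩⟩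
    rw [h2]
    exact eq_sub_of_add_eq' (intervalIntegral.integral_interval_add_Ioi hint.integrableOn
      hint.integrableOn)
  have hlocG : LocallyIntegrableOn (fun x => ∫ y in Ioo x b, m y) (Ioo a b) := by
    refine ContinuousOn.locallyIntegrableOn (fun x hx => ?_) measurableSet_Ioo
    have hx' : (a + x) / 2 ∈ Ioo a b := ⟨by linarith [hx.1], by linarith [hx.1, hx.2]⟩
    exact ((hcont _ hx').continuousAt (isOpen_Ioo.mem_nhds
      ⟨by linarith [hx.1], hx.2⟩)).continuousWithinAt
  refine ⟨hlocG, hloc.neg, fun ψ hψ hc hs => ?_⟩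
  obtain ⟨α, hα, hKα⟩ := hsub hc hs
  -- Integrability of `m` up to `a` is not assumed. Since the support of `ψ` lies in `(α, b)`, the
  -- truncation changes nothing, and Fubini applies on the region `x < y`, where the inner integral
  -- of `ψ'` is `ψ y`.
  set M := (Ioo α b).indicator m with hM
  have hint : Integrable M := (hm α hα).integrable_indicator measurableSet_Ioo
  have hdi : Integrable (deriv ψ) :=
    (hψ.continuous_deriv (by simp)).integrable_of_hasCompactSupport hc.deriv
  have e1 : ∀ x, deriv ψ x • ∫ y in Ioo x b, m y
      = ∫ y, {p : ℝ × ℝ | p.1 < p.2}.indicator (fun p => deriv ψ p.1 • M p.2) (x, y) := by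
    intro x
    by_cases hx : x ∈ tsupport ψ
    · have h2 : ∫ y in Ioo x b, m y = ∫ y in Ioi x, M y := by
        rw [hM, setIntegral_indicator measurableSet_Ioo]
        congr 2
        ext y
        simp only [mem_Ioo, mem_inter_iff, mem_Ioi]
        exact ⟨fun h => ⟨h.1, (hKα hx).1.trans h.1, h.2⟩, fun h => ⟨h.1, h.2.2⟩⟩
      rw [h2, ← integral_smul, ← integral_indicator measurableSet_Ioi]
      rfl
    · rw [image_eq_zero_of_notMem_tsupport fun h' => hx (tsupport_deriv_subset (f := ψ) h'),
        zero_smul, eq_comm]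
      refine integral_eq_zero_of_ae (.of_forall fun y => ?_)
      simp only [indicator_apply,
        image_eq_zero_of_notMem_tsupport fun h' => hx (tsupport_deriv_subset (f := ψ) h')]
      simp
  have hprod : Integrable (fun p : ℝ × ℝ =>
      {p : ℝ × ℝ | p.1 < p.2}.indicator (fun p => deriv ψ p.1 • M p.2) p)
      ((volume : Measure ℝ).prod volume) :=
    (hdi.smul_prod hint).indicator (measurableSet_lt measurable_fst measurable_snd)
  simp only [e1]
  rw [integral_integral_swap (f := fun x y =>
    {p : ℝ × ℝ | p.1 < p.2}.indicator (fun p => deriv ψ p.1 • M p.2) (x, y)) hprod]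
  simp only [smul_neg, integral_neg, neg_neg]
  refine integral_congr_ae (.of_forall fun y => ?_)
  have e2 : ∫ x, {p : ℝ × ℝ | p.1 < p.2}.indicator (fun p => deriv ψ p.1 • M p.2) (x, y)
      = ψ y • M y := by
    rw [← hc.integral_Iic_deriv_eq (hψ.of_le (by simp)) y, integral_Iic_eq_integral_Iio,
      ← integral_smul_const, ← integral_indicator measurableSet_Iio]
    rfl
  simp only [e2]
  by_cases hy : y ∈ tsupport ψ
  · rw [hM, indicator_of_mem (hKα hy)]
  · simp [image_eq_zero_of_notMem_tsupport hy]

lemma HasWeakDerivOn.comp_sub_left {f u : ℝ → ℂ} {c : ℝ} (h : HasWeakDerivOn f u (Ioo 0 c)) :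
    HasWeakDerivOn (fun x => f (c - x)) (fun x => - u (c - x)) (Ioo 0 c) := by
  have hloc : ∀ {v : ℝ → ℂ}, LocallyIntegrableOn v (Ioo 0 c) →
      LocallyIntegrableOn (fun x => v (c - x)) (Ioo 0 c) := fun {v} hv => by
    refine (locallyIntegrableOn_iff isOpen_Ioo.isLocallyClosed).2 fun K hs hK => ?_
    have h1 : IntegrableOn v ((fun x => c - x) '' K) := by
      refine hv.integrableOn_compact_subset ?_ (hK.image (by fun_prop))
      rintro _ ⟨x, hx, rfl⟩
      exact ⟨by linarith [(hs hx).2], by linarith [(hs hx).1]⟩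
    have h2 := ((Measure.measurePreserving_sub_left volume c).integrableOn_comp_preimage
      (Homeomorph.subLeft c).measurableEmbedding (f := v) (s := (fun x => c - x) '' K)).2 h1
    rwa [preimage_image_eq _ (sub_right_injective)] at h2
  refine ⟨hloc h.1, (hloc h.2.1).neg, fun ψ hψ hc hs => ?_⟩
  have key := h.2.2 (fun x => ψ (c - x)) (hψ.comp (contDiff_const.sub contDiff_id))
    (hc.comp_homeomorph (Homeomorph.subLeft c)) ?_
  · simp only [deriv_comp_const_sub, neg_smul, integral_neg, neg_inj] at key
    rw [← integral_sub_left_eq_self (fun x => deriv ψ x • f (c - x)) volume c,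
      ← integral_sub_left_eq_self (fun x => ψ x • - u (c - x)) volume c]
    simp only [sub_sub_cancel, smul_neg, integral_neg, neg_neg]
    exact key
  · intro x hx
    have h1 : c - x ∈ tsupport ψ :=
      tsupport_comp_subset_preimage ψ (f := fun x => c - x) (by fun_prop) hx
    exact ⟨by linarith [(hs h1).2], by linarith [(hs h1).1]⟩

lemma ENNReal.sq_lintegral_mul_le {α : Type*} [MeasurableSpace α] (μ : Measure α)
    {f g : α → ENNReal} (hf : AEMeasurable f μ) (hg : AEMeasurable g μ) :
    (∫⁻ a, f a * g a ∂μ) ^ 2 ≤ (∫⁻ a, f a ^ 2 ∂μ) * ∫⁻ a, g a ^ 2 ∂μ := by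
  have h := ENNReal.lintegral_mul_le_Lp_mul_Lq μ Real.HolderConjugate.two_two hf hg
  simp only [Pi.mul_apply, ENNReal.rpow_two] at h
  calc (∫⁻ a, f a * g a ∂μ) ^ 2
      ≤ ((∫⁻ a, f a ^ 2 ∂μ) ^ (1 / 2 : ℝ) * (∫⁻ a, g a ^ 2 ∂μ) ^ (1 / 2 : ℝ)) ^ 2 := by gcongr
    _ = _ := by
      rw [mul_pow, ← ENNReal.rpow_two, ← ENNReal.rpow_two, ← ENNReal.rpow_mul, ← ENNReal.rpow_mul]
      norm_num

/-! ### The travel-time coordinate and the kernel estimates -/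

namespace PeakedWave

/-- The coefficient `c_*² - 2η_*` in the coordinate of the interval `(0, 2π)`. -/
def weight (x : ℝ) : ℝ := x * (2 * π - x) / 4

/-- The primitive of `1 / weight` that vanishes at `π`. -/
def travelTime (x : ℝ) : ℝ := 2 / π * (Real.log x - Real.log (2 * π - x))

/-- The solution `exp (μ s)`, `s = travelTime`, of the equation `weight * φ' = μ * φ`. -/
def flowExp (μ : ℂ) (x : ℝ) : ℂ := Complex.exp (μ * travelTime x)

lemma cStar_sq_sub_two_mul_etaStar {x : ℝ} (hx : x ∈ Ioo 0 (2 * π)) :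
    cStar ^ 2 - 2 * etaStar (x : Torus) = weight x := by
  rw [etaStar_coe hx, cStar, weight, div_pow, mul_pow, Real.sq_sqrt (by norm_num)]
  ring

lemma weight_pos {x : ℝ} (hx : x ∈ Ioo 0 (2 * π)) : 0 < weight x :=
  div_pos (mul_pos hx.1 (sub_pos.2 hx.2)) (by norm_num)

lemma weight_ofReal_ne_zero {x : ℝ} (hx : x ∈ Ioo 0 (2 * π)) : (weight x : ℂ) ≠ 0 :=
  Complex.ofReal_ne_zero.2 (weight_pos hx).ne'

lemma measurable_weight : Measurable weight := by unfold weight; fun_prop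

lemma measurable_travelTime : Measurable travelTime := by unfold travelTime; fun_prop

lemma measurable_flowExp (μ : ℂ) : Measurable (flowExp μ) := by
  have := measurable_travelTime
  unfold flowExp
  fun_prop

lemma hasDerivAt_travelTime {x : ℝ} (hx : x ∈ Ioo 0 (2 * π)) :
    HasDerivAt travelTime (1 / weight x) x := by
  have h1 : x ≠ 0 := hx.1.ne'
  have h2 : 2 * π - x ≠ 0 := (sub_pos.2 hx.2).ne'
  refine (((Real.hasDerivAt_log h1).fun_sub
    (((hasDerivAt_id' x).const_sub (2 * π)).log h2)).const_mul (2 / π)).congr_deriv ?_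
  rw [weight]
  field_simp
  ring

lemma contDiffOn_travelTime : ContDiffOn ℝ ∞ travelTime (Ioo 0 (2 * π)) :=
  contDiffOn_const.mul ((contDiffOn_id.log fun _ hx => hx.1.ne').sub
    ((contDiffOn_const.sub contDiffOn_id).log fun _ hx => (sub_pos.2 hx.2).ne'))

lemma contDiffOn_flowExp (μ : ℂ) : ContDiffOn ℝ ∞ (flowExp μ) (Ioo 0 (2 * π)) :=
  (contDiffOn_const.mul (Complex.ofRealCLM.contDiff.comp_contDiffOn contDiffOn_travelTime)).cexp

lemma deriv_flowExp (μ : ℂ) {x : ℝ} (hx : x ∈ Ioo 0 (2 * π)) :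
    deriv (flowExp μ) x = μ * flowExp μ x / weight x := by
  have h := (((hasDerivAt_travelTime hx).ofReal_comp).const_mul μ).cexp
  refine h.deriv.trans ?_
  simp only [flowExp]
  push_cast
  ring

lemma flowExp_ne_zero (μ : ℂ) (x : ℝ) : flowExp μ x ≠ 0 := Complex.exp_ne_zero _

lemma norm_flowExp (μ : ℂ) (x : ℝ) : ‖flowExp μ x‖ = Real.exp (μ.re * travelTime x) := by
  rw [flowExp, Complex.norm_exp, Complex.re_mul_ofReal]

lemma flowExp_neg_mul (μ : ℂ) (x : ℝ) : flowExp (-μ) x * flowExp μ x = 1 := by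
  rw [flowExp, flowExp, ← Complex.exp_add]
  simp

lemma exp_travelTime {x : ℝ} (hx : x ∈ Ioo 0 (2 * π)) (c : ℝ) :
    Real.exp (c * travelTime x) = (x / (2 * π - x)) ^ (2 * c / π) := by
  rw [Real.rpow_def_of_pos (div_pos hx.1 (sub_pos.2 hx.2)),
    Real.log_div hx.1.ne' (sub_pos.2 hx.2).ne', travelTime]
  congr 1
  ring

/-- The source of the threshold `π / 4`: at this exponent the factor `√(weight x)`, which passes
from `L²(dx)` to `L²(ds)`, cancels the singularity at `2π` and leaves an increasing function. -/
lemma sqrt_weight_mul_exp {x : ℝ} (hx : x ∈ Ioo 0 (2 * π)) :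
    √(weight x) * Real.exp (π / 4 * travelTime x) = x / 2 := by
  have h2 : 0 < 2 * π - x := sub_pos.2 hx.2
  have h3 : 2 * (π / 4) / π = 1 / 2 := by field_simp; norm_num
  rw [exp_travelTime hx, h3, ← Real.sqrt_eq_rpow, ← Real.sqrt_mul (weight_pos hx).le,
    show weight x * (x / (2 * π - x)) = (x / 2) ^ 2 by rw [weight]; field_simp; norm_num,
    Real.sqrt_sq (by linarith [hx.1])]

lemma strictMonoOn_travelTime : StrictMonoOn travelTime (Ioo 0 (2 * π)) := by
  intro x hx y hy hxy
  have h1 := Real.log_lt_log hx.1 hxy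
  have h2 := Real.log_lt_log (sub_pos.2 hy.2) (sub_lt_sub_left hxy (2 * π))
  exact mul_lt_mul_of_pos_left (by linarith) (by positivity)

/-- Splitting off `exp (π s / 4)` and using that `x / 2 ≤ y / 2` bounds the resolvent kernel by `exp
(-k (s(y) - s(x)))`, `k = a - π/4`, with the weights `1 / √w` of the change of variables to `s`. -/
lemma kernel_le {a x y : ℝ} (hx : x ∈ Ioo 0 (2 * π)) (hy : y ∈ Ioo 0 (2 * π)) (hxy : x ≤ y) :
    Real.exp (a * travelTime x) / (Real.exp (a * travelTime y) * weight y) ≤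
      Real.exp ((a - π / 4) * travelTime x) / √(weight x) *
        (Real.exp (-((a - π / 4) * travelTime y)) / √(weight y)) := by
  have hwx := Real.sqrt_pos.2 (weight_pos hx)
  have hwy := Real.sqrt_pos.2 (weight_pos hy)
  have h1 := sqrt_weight_mul_exp hx
  have h2 := sqrt_weight_mul_exp hy
  have e : ∀ z, Real.exp (a * travelTime z)
      = Real.exp ((a - π / 4) * travelTime z) * Real.exp (π / 4 * travelTime z) := fun z => by
    rw [← Real.exp_add]; ring_nf
  rw [e x, e y, Real.exp_neg]
  set A := Real.exp ((a - π / 4) * travelTime x)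
  set B := Real.exp ((a - π / 4) * travelTime y)
  have hA : 0 < A := Real.exp_pos _
  have hB : 0 < B := Real.exp_pos _
  have hP := Real.exp_pos (π / 4 * travelTime x)
  have hQ := Real.exp_pos (π / 4 * travelTime y)
  set P := Real.exp (π / 4 * travelTime x)
  set Q := Real.exp (π / 4 * travelTime y)
  have hw := Real.sq_sqrt (weight_pos hy).le
  set X := √(weight x)
  set Y := √(weight y)
  rw [← hw]
  have h3 : X * P ≤ Y * Q := by rw [h1, h2]; linarith
  rw [show A / X * (B⁻¹ / Y) = A / (X * B * Y) by field_simp,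
    div_le_div_iff₀ (by positivity) (by positivity)]
  calc A * P * (X * B * Y) = A * B * Y * (X * P) := by ring
    _ ≤ A * B * Y * (Y * Q) := by gcongr
    _ = _ := by ring

/-- The integrand is minus the derivative of the antitone function `exp (-k s) / k`, so its integral
is the length of the image. This avoids limits at the singular endpoint. -/
lemma lintegral_exp_neg_travelTime_le {k x : ℝ} (hk : 0 < k) (hx : x ∈ Ioo 0 (2 * π)) :
    ∫⁻ y in Ioo x (2 * π), ENNReal.ofReal (Real.exp (-(k * travelTime y)) / weight y) ≤
      ENNReal.ofReal (Real.exp (-(k * travelTime x)) / k) := by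
  have hsub : Ioo x (2 * π) ⊆ Ioo 0 (2 * π) := Ioo_subset_Ioo_left hx.1.le
  have hd : ∀ y ∈ Ioo x (2 * π), HasDerivWithinAt (fun y => Real.exp (-(k * travelTime y)) / k)
      (-(Real.exp (-(k * travelTime y)) / weight y)) (Ioo x (2 * π)) y := fun y hy => by
    refine (((hasDerivAt_travelTime (hsub hy)).const_mul k).fun_neg.exp.div_const
      k).hasDerivWithinAt.congr_deriv ?_
    have := (weight_pos (hsub hy)).ne'
    field_simp
  have hle : ∀ y ∈ Ioo 0 (2 * π), ∀ z ∈ Ioo 0 (2 * π), y ≤ z →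
      Real.exp (-(k * travelTime z)) / k ≤ Real.exp (-(k * travelTime y)) / k :=
    fun y hy z hz hyz => by
      have := strictMonoOn_travelTime.monotoneOn hy hz hyz
      gcongr
  have h := lintegral_deriv_eq_volume_image_of_antitoneOn measurableSet_Ioo hd
    fun y hy z hz hyz => hle y (hsub hy) z (hsub hz) hyz
  simp only [neg_neg] at h
  rw [h]
  refine (measure_mono (t := Icc 0 (Real.exp (-(k * travelTime x)) / k)) ?_).trans
    (by rw [Real.volume_Icc, sub_zero])
  rintro _ ⟨y, hy, rfl⟩
  exact ⟨by positivity, hle x hx y (hsub hy) hy.1.le⟩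

lemma lintegral_exp_travelTime_le {k y : ℝ} (hk : 0 < k) (hy : y ∈ Ioo 0 (2 * π)) :
    ∫⁻ x in Ioo 0 y, ENNReal.ofReal (Real.exp (k * travelTime x) / weight x) ≤
      ENNReal.ofReal (Real.exp (k * travelTime y) / k) := by
  have hsub : Ioo 0 y ⊆ Ioo 0 (2 * π) := Ioo_subset_Ioo_right hy.2.le
  have hd : ∀ x ∈ Ioo 0 y, HasDerivWithinAt (fun x => Real.exp (k * travelTime x) / k)
      (Real.exp (k * travelTime x) / weight x) (Ioo 0 y) x := fun x hx => by
    refine (((hasDerivAt_travelTime (hsub hx)).const_mul k).exp.div_const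
      k).hasDerivWithinAt.congr_deriv ?_
    have := (weight_pos (hsub hx)).ne'
    field_simp
  have hle : ∀ x ∈ Ioo 0 (2 * π), ∀ z ∈ Ioo 0 (2 * π), x ≤ z →
      Real.exp (k * travelTime x) / k ≤ Real.exp (k * travelTime z) / k :=
    fun x hx z hz hxz => by
      have := strictMonoOn_travelTime.monotoneOn hx hz hxz
      gcongr
  rw [lintegral_deriv_eq_volume_image_of_monotoneOn measurableSet_Ioo hd
    fun x hx z hz hxz => hle x (hsub hx) z (hsub hz) hxz]
  refine (measure_mono (t := Icc 0 (Real.exp (k * travelTime y) / k)) ?_).trans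
    (by rw [Real.volume_Icc, sub_zero])
  rintro _ ⟨x, hx, rfl⟩
  exact ⟨by positivity, hle x (hsub hx) y hy hx.2.le⟩

/-- First half of the Schur test: Cauchy–Schwarz with the factor `exp (-k s(y))` of the kernel
shared equally between `p` and `q`. The integral of `p²` is at most `exp (-k s(x)) / k`. -/
lemma sq_lintegral_kernel_le {μ : ℂ} (hμ : π / 4 < μ.re) {g : ℝ → ℂ} (hg : Measurable g) {x : ℝ}
    (hx : x ∈ Ioo 0 (2 * π)) :
    (∫⁻ y in Ioo x (2 * π), ‖flowExp μ x * (g y / (flowExp μ y * weight y))‖ₑ) ^ 2 ≤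
      ENNReal.ofReal (Real.exp ((μ.re - π / 4) * travelTime x) / weight x / (μ.re - π / 4)) *
        ∫⁻ y in Ioo x (2 * π),
          ENNReal.ofReal (Real.exp (-((μ.re - π / 4) * travelTime y))) * ‖g y‖ₑ ^ 2 := by
  set k := μ.re - π / 4 with hkdef
  have hk : 0 < k := sub_pos.2 hμ
  have hsub : Ioo x (2 * π) ⊆ Ioo 0 (2 * π) := Ioo_subset_Ioo_left hx.1.le
  have mw := measurable_weight
  have mt := measurable_travelTime
  let p : ℝ → ENNReal := fun y =>
    ENNReal.ofReal (√(Real.exp (-(k * travelTime y)) / weight y))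
  let q : ℝ → ENNReal := fun y => ENNReal.ofReal (√(Real.exp (-(k * travelTime y)))) * ‖g y‖ₑ
  have hp : Measurable p := by fun_prop
  have hq : Measurable q := by fun_prop
  have hbound : ∫⁻ y in Ioo x (2 * π), ‖flowExp μ x * (g y / (flowExp μ y * weight y))‖ₑ ≤
      ENNReal.ofReal (Real.exp (k * travelTime x) / √(weight x)) *
        ∫⁻ y in Ioo x (2 * π), p y * q y := by
    rw [← lintegral_const_mul _ (hp.fun_mul hq)]
    refine setLIntegral_mono' measurableSet_Ioo fun y hy => ?_
    have hwy := weight_pos (hsub hy)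
    have h1 := kernel_le (a := μ.re) hx (hsub hy) hy.1.le
    rw [← hkdef] at h1
    have h2 : ‖flowExp μ x * (g y / (flowExp μ y * weight y))‖ =
        Real.exp (μ.re * travelTime x) / (Real.exp (μ.re * travelTime y) * weight y) * ‖g y‖ := by
      rw [norm_mul, norm_div, norm_mul, norm_flowExp, norm_flowExp, Complex.norm_real,
        Real.norm_of_nonneg hwy.le]
      ring
    have h3 : Real.exp (-(k * travelTime y)) / √(weight y) =
        √(Real.exp (-(k * travelTime y)) / weight y) * √(Real.exp (-(k * travelTime y))) := by
      rw [Real.sqrt_div (Real.exp_pos _).le, div_mul_eq_mul_div,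
        Real.mul_self_sqrt (Real.exp_pos _).le]
    rw [← ofReal_norm, h2, ENNReal.ofReal_mul (by positivity), ofReal_norm]
    rw [h3] at h1
    calc _ ≤ ENNReal.ofReal (Real.exp (k * travelTime x) / √(weight x) *
          (√(Real.exp (-(k * travelTime y)) / weight y) *
            √(Real.exp (-(k * travelTime y))))) * ‖g y‖ₑ := by gcongr
      _ = _ := by
        rw [ENNReal.ofReal_mul (by positivity), ENNReal.ofReal_mul (by positivity)]
        simp only [p, q]
        ring
  have hp2 : ∀ y ∈ Ioo x (2 * π),
      p y ^ 2 = ENNReal.ofReal (Real.exp (-(k * travelTime y)) / weight y) := fun y hy => by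
    have hwy := weight_pos (hsub hy)
    rw [← ENNReal.ofReal_pow (by positivity), Real.sq_sqrt (by positivity)]
  have hq2 : ∀ y, q y ^ 2 = ENNReal.ofReal (Real.exp (-(k * travelTime y))) * ‖g y‖ₑ ^ 2 :=
    fun y => by
      rw [mul_pow, ← ENNReal.ofReal_pow (by positivity), Real.sq_sqrt (by positivity)]
  have hcs := ENNReal.sq_lintegral_mul_le (volume.restrict (Ioo x (2 * π))) hp.aemeasurable
    hq.aemeasurable
  rw [setLIntegral_congr_fun measurableSet_Ioo hp2] at hcs
  simp only [hq2] at hcs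
  have hwx := weight_pos hx
  calc _ ≤ (ENNReal.ofReal (Real.exp (k * travelTime x) / √(weight x)) *
        ∫⁻ y in Ioo x (2 * π), p y * q y) ^ 2 := by gcongr
    _ ≤ ENNReal.ofReal (Real.exp (k * travelTime x) / √(weight x)) ^ 2 *
        (ENNReal.ofReal (Real.exp (-(k * travelTime x)) / k) * ∫⁻ y in Ioo x (2 * π),
          ENNReal.ofReal (Real.exp (-(k * travelTime y))) * ‖g y‖ₑ ^ 2) := by
      rw [mul_pow]
      gcongr
      exact hcs.trans (by gcongr; exact lintegral_exp_neg_travelTime_le hk hx)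
    _ = _ := by
      rw [← mul_assoc, ← ENNReal.ofReal_pow (by positivity), ← ENNReal.ofReal_mul (by positivity)]
      congr 2
      rw [div_pow, Real.sq_sqrt hwx.le, Real.exp_neg]
      field_simp

/-- Second half of the Schur test: after Tonelli the integral over `x < y` is at most `exp (k s(y))
/ k`, which cancels the factor `exp (-k s(y))`. Each half contributes one factor `1 / k`. -/
lemma lintegral_sq_lintegral_kernel_le {μ : ℂ} (hμ : π / 4 < μ.re) {g : ℝ → ℂ}
    (hg : Measurable g) :
    ∫⁻ x in Ioo 0 (2 * π),
      (∫⁻ y in Ioo x (2 * π), ‖flowExp μ x * (g y / (flowExp μ y * weight y))‖ₑ) ^ 2 ≤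
      ENNReal.ofReal (1 / (μ.re - π / 4)) ^ 2 * ∫⁻ y in Ioo 0 (2 * π), ‖g y‖ₑ ^ 2 := by
  set k := μ.re - π / 4 with hkdef
  have hk : 0 < k := sub_pos.2 hμ
  have mw := measurable_weight
  have mt := measurable_travelTime
  let v : ℝ → ENNReal := fun x => ENNReal.ofReal (Real.exp (k * travelTime x) / weight x / k)
  let h : ℝ → ENNReal := fun y => ENNReal.ofReal (Real.exp (-(k * travelTime y))) * ‖g y‖ₑ ^ 2
  have hv : Measurable v := by fun_prop
  have hh : Measurable h := by fun_prop
  let T : Set (ℝ × ℝ) := {p | p.1 < p.2}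
  have hT : MeasurableSet T := measurableSet_lt measurable_fst measurable_snd
  have hm : Measurable (Function.uncurry fun x y => T.indicator (fun p => v p.1 * h p.2) (x, y)) :=
    ((hv.comp measurable_fst).mul (hh.comp measurable_snd)).indicator hT
  calc _ ≤ ∫⁻ x in Ioo 0 (2 * π), ∫⁻ y in Ioo 0 (2 * π),
        T.indicator (fun p => v p.1 * h p.2) (x, y) := by
        refine setLIntegral_mono' measurableSet_Ioo fun x hx => ?_
        refine (sq_lintegral_kernel_le hμ hg hx).trans_eq ?_
        rw [← lintegral_const_mul _ hh, ← lintegral_indicator measurableSet_Ioo,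
          ← lintegral_indicator measurableSet_Ioo]
        congr 1
        ext y
        simp only [indicator_apply, mem_Ioo, T, mem_ofPred_eq]
        by_cases h1 : x < y <;> by_cases h2 : y < 2 * π <;> simp [h1, h2, hx.1.trans, v, h, hkdef]
    _ = ∫⁻ y in Ioo 0 (2 * π), ∫⁻ x in Ioo 0 (2 * π),
        T.indicator (fun p => v p.1 * h p.2) (x, y) := lintegral_lintegral_swap hm.aemeasurable
    _ ≤ ∫⁻ y in Ioo 0 (2 * π), ENNReal.ofReal (1 / k) ^ 2 * ‖g y‖ₑ ^ 2 := by
        refine setLIntegral_mono' measurableSet_Ioo fun y hy => ?_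
        have e : ∫⁻ x in Ioo 0 (2 * π), T.indicator (fun p => v p.1 * h p.2) (x, y) =
            (∫⁻ x in Ioo 0 y, ENNReal.ofReal (Real.exp (k * travelTime x) / weight x)) *
              (ENNReal.ofReal (1 / k) * h y) := by
          rw [← lintegral_mul_const _ (by fun_prop), ← lintegral_indicator measurableSet_Ioo,
            ← lintegral_indicator measurableSet_Ioo]
          congr 1
          ext x
          simp only [indicator_apply, mem_Ioo, T, mem_ofPred_eq]
          by_cases h1 : x < y
          · by_cases h2 : 0 < x
            · have hx : x ∈ Ioo 0 (2 * π) := ⟨h2, h1.trans hy.2⟩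
              have := weight_pos hx
              simp only [h1, h2, hx.2, and_self, if_true, v]
              rw [div_eq_mul_one_div _ k, ENNReal.ofReal_mul (by positivity), mul_assoc]
            · simp [h2]
          · simp [h1]
        rw [e]
        calc _ ≤ ENNReal.ofReal (Real.exp (k * travelTime y) / k) *
              (ENNReal.ofReal (1 / k) * h y) := by
              gcongr
              exact lintegral_exp_travelTime_le hk hy
          _ = _ := by
              simp only [h]
              rw [← mul_assoc, ← mul_assoc, ← ENNReal.ofReal_mul (by positivity),
                ← ENNReal.ofReal_mul (by positivity), ← ENNReal.ofReal_pow (by positivity)]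
              congr 2
              rw [Real.exp_neg]
              field_simp
    _ = _ := by
        rw [lintegral_const_mul _ (by fun_prop)]

end PeakedWave

/-! ### Abstract criteria for the resolvent set and the spectrum -/

/-- If `T - μ` has trivial kernel and `T x - μ x = y` has a solution with `‖x‖ ≤ C ‖y‖` for every
`y`, then `μ` belongs to the resolvent set of `T`. -/
lemma mem_unboundedResolventSet_of_exists_bound {E : Type*} [NormedAddCommGroup E]
    [NormedSpace ℂ E] {T : E →ₗ.[ℂ] E} {μ : ℂ} (C : ℝ)
    (hker : ∀ x : T.domain, T x = μ • (x : E) → (x : E) = 0)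
    (hsolve : ∀ y : E, ∃ x : T.domain, T x - μ • (x : E) = y ∧ ‖(x : E)‖ ≤ C * ‖y‖) :
    μ ∈ unboundedResolventSet T := by
  have huniq : ∀ x₁ x₂ : T.domain, T x₁ - μ • (x₁ : E) = T x₂ - μ • (x₂ : E) → x₁ = x₂ := by
    intro x₁ x₂ h
    have h0 := hker (x₁ - x₂) (by
      rw [LinearPMap.map_sub, Submodule.coe_sub, smul_sub, ← sub_eq_zero]
      rw [← sub_eq_zero] at h
      rw [← h]
      abel)
    exact sub_eq_zero.1 (Subtype.ext h0)
  choose r hr hb using hsolve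
  -- The chosen solutions depend linearly on the right-hand side because solutions are unique.
  let R : E →ₗ[ℂ] E :=
    { toFun := fun y => r y
      map_add' := fun y z => by
        rw [← Submodule.coe_add, huniq (r (y + z)) (r y + r z)]
        rw [hr, LinearPMap.map_add, Submodule.coe_add, smul_add, add_sub_add_comm, hr, hr]
      map_smul' := fun c y => by
        rw [RingHom.id_apply, ← Submodule.coe_smul, huniq (r (c • y)) (c • r y)]
        rw [hr, LinearPMap.map_smul, Submodule.coe_smul, smul_comm μ c, ← smul_sub, hr] }
  refine ⟨R.mkContinuous C hb, fun y => ⟨(r y).2, hr y⟩, fun x => ?_⟩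
  exact congrArg Subtype.val (huniq (r (T x - μ • (x : E))) x (hr _))

/-- An eigenvalue is at distance at least `‖R‖⁻¹` from a point with resolvent `R`, so the closure
of the set of eigenvalues lies in the spectrum. -/
lemma mem_unboundedSpectrum_of_mem_closure {E : Type*} [NormedAddCommGroup E]
    [NormedSpace ℂ E] {T : E →ₗ.[ℂ] E} {μ : ℂ} {S : Set ℂ}
    (hS : ∀ z ∈ S, ∃ x : T.domain, (x : E) ≠ 0 ∧ T x = z • (x : E)) (hμ : μ ∈ closure S) :
    μ ∈ unboundedSpectrum T := by
  rintro ⟨R, -, hR⟩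
  obtain ⟨z, hz, hd⟩ := Metric.mem_closure_iff.1 hμ (1 / (‖R‖ + 1)) (by positivity)
  obtain ⟨x, hx0, hx⟩ := hS z hz
  have h := hR x
  rw [hx, ← sub_smul, map_smul] at h
  have hpos : 0 < ‖(x : E)‖ := norm_pos_iff.2 hx0
  rw [dist_comm, dist_eq_norm, lt_div_iff₀ (by positivity)] at hd
  have h1 : ‖(x : E)‖ ≤ ‖z - μ‖ * (‖R‖ * ‖(x : E)‖) := by
    conv_lhs => rw [← h, norm_smul]
    gcongr
    exact R.le_opNorm _
  nlinarith [norm_nonneg (z - μ), norm_nonneg R]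

/-- The resolvent set is symmetric under `μ ↦ -μ` if an isometric involution anticommutes with
the operator. -/
lemma neg_mem_unboundedResolventSet {E : Type*} [NormedAddCommGroup E] [NormedSpace ℂ E]
    {T : E →ₗ.[ℂ] E} (J : E →L[ℂ] E) (hJ : ∀ x, J (J x) = x)
    (hT : ∀ x : T.domain, ∃ h : J x ∈ T.domain, T ⟨J x, h⟩ = - J (T x)) {μ : ℂ}
    (hμ : μ ∈ unboundedResolventSet T) : -μ ∈ unboundedResolventSet T := by
  obtain ⟨R, h1, h2⟩ := hμ
  refine ⟨-(J.comp (R.comp J)), fun y => ?_, fun x => ?_⟩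
  · obtain ⟨hy, e⟩ := h1 (J y)
    obtain ⟨hJy, eJ⟩ := hT ⟨R (J y), hy⟩
    refine ⟨T.domain.neg_mem hJy, ?_⟩
    have e2 : T ⟨-J (R (J y)), T.domain.neg_mem hJy⟩ = - T ⟨J (R (J y)), hJy⟩ :=
      LinearPMap.map_neg T ⟨J (R (J y)), hJy⟩
    change T ⟨-J (R (J y)), _⟩ - -μ • -J (R (J y)) = y
    rw [e2, eJ, neg_neg, neg_smul_neg, ← map_smul, ← map_sub, e, hJ]
  · obtain ⟨hx, e⟩ := hT x
    have h3 := h2 ⟨J x, hx⟩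
    change -J (R (J (T x - -μ • (x : E)))) = x
    rw [neg_smul, sub_neg_eq_add, map_add, map_smul, ← neg_neg (J (T x)), ← e, ← map_neg,
      ← map_neg, neg_add, neg_neg, ← sub_eq_add_neg, h3, hJ]

/-! ### Transfer between the circle and the interval -/

namespace PeakedWave

lemma measurePreserving_coe : MeasurePreserving ((↑) : ℝ → Torus)
    (volume.restrict (Ioo 0 (2 * π))) volume := by
  have h0 := AddCircle.measurePreserving_mk (2 * π) 0
  rw [zero_add] at h0
  rwa [← Measure.restrict_congr_set Ioo_ae_eq_Ioc] at h0

lemma measurable_comp_coe (f : L2) : Measurable fun x : ℝ => f (x : Torus) :=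
  (Lp.stronglyMeasurable f).measurable.comp AddCircle.measurable_mk'

lemma memLp_comp_coe (f : L2) :
    MemLp (fun x : ℝ => f (x : Torus)) 2 (volume.restrict (Ioo 0 (2 * π))) :=
  (Lp.memLp f).comp_measurePreserving measurePreserving_coe

lemma eLpNorm_two_sq {α : Type*} [MeasurableSpace α] (f : α → ℂ) (ν : Measure α) :
    eLpNorm f 2 ν ^ 2 = ∫⁻ x, ‖f x‖ₑ ^ 2 ∂ν := by
  simpa using eLpNorm_nnreal_pow_eq_lintegral (f := f) (μ := ν) (p := 2) two_ne_zero

lemma enorm_sq_eq (f : L2) : ‖f‖ₑ ^ 2 = ∫⁻ x in Ioo 0 (2 * π), ‖f ((x : ℝ) : Torus)‖ₑ ^ 2 := by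
  rw [Lp.enorm_def, ← eLpNorm_comp_measurePreserving (Lp.aestronglyMeasurable f)
    measurePreserving_coe, eLpNorm_two_sq]
  rfl

lemma exists_L2_of_memLp {F : ℝ → ℂ} (hF : MemLp F 2 (volume.restrict (Ioo 0 (2 * π)))) :
    ∃ f : L2, ∀ᵐ x : ℝ ∂volume.restrict (Ioo 0 (2 * π)), F x = f (x : Torus) := by
  have hF' : MemLp F 2 (volume.restrict (Ioc 0 (0 + 2 * π))) := by
    rwa [zero_add, ← Measure.restrict_congr_set Ioo_ae_eq_Ioc]
  refine ⟨hF'.memLp_liftIoc.toLp _, ?_⟩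
  filter_upwards [ae_coe hF'.memLp_liftIoc.coeFn_toLp, ae_restrict_mem measurableSet_Ioo]
    with x hx hxm
  rw [hx, AddCircle.liftIoc_coe_apply]
  exact ⟨hxm.1, by linarith [hxm.2]⟩

lemma L2_ext_of_ae {f g : L2}
    (h : ∀ᵐ x : ℝ ∂volume.restrict (Ioo 0 (2 * π)), f (x : Torus) = g (x : Torus)) : f = g :=
  Lp.ext (ae_of_ae_coe (nullMeasurableSet_eq_fun (Lp.aestronglyMeasurable f).aemeasurable
    (Lp.aestronglyMeasurable g).aemeasurable) h)

/-- A function with `weight * u = g` for its weak derivative `u`, as an element of `L²(𝕋)`. -/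
lemma isWeightedDeriv_of_ae {f g : L2} {F u : ℝ → ℂ} (hu : HasWeakDerivOn F u (Ioo 0 (2 * π)))
    (hF : ∀ᵐ x : ℝ ∂volume.restrict (Ioo 0 (2 * π)), F x = f (x : Torus))
    (hg : ∀ᵐ x : ℝ ∂volume.restrict (Ioo 0 (2 * π)), g (x : Torus) = weight x * u x) :
    IsWeightedDeriv f g := by
  refine ⟨u, hu.congr isOpen_Ioo hF, ?_⟩
  filter_upwards [hg, ae_restrict_mem measurableSet_Ioo] with x hx hxm
  rw [hx, cStar_sq_sub_two_mul_etaStar hxm]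

/-! ### The equation `w f' = μ f + g` to the right of the strip -/

lemma integrableOn_div_flowExp {μ : ℂ} (hμ : π / 4 < μ.re) (g : L2) {x : ℝ}
    (hx : x ∈ Ioo 0 (2 * π)) :
    IntegrableOn (fun y : ℝ => g (y : Torus) / (flowExp μ y * weight y)) (Ioo x (2 * π)) := by
  have hg := measurable_comp_coe g
  have mw := measurable_weight
  have mf := measurable_flowExp μ
  have hm : Measurable fun y : ℝ => g (y : Torus) / (flowExp μ y * weight y) := by fun_prop
  have hfin : ∫⁻ y in Ioo 0 (2 * π), ‖g ((y : ℝ) : Torus)‖ₑ ^ 2 < ⊤ := by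
    rw [← enorm_sq_eq]
    exact ENNReal.pow_lt_top enorm_lt_top
  have hle : ∫⁻ y in Ioo x (2 * π), ENNReal.ofReal
      (Real.exp (-((μ.re - π / 4) * travelTime y))) * ‖g (y : Torus)‖ₑ ^ 2 ≤
      ENNReal.ofReal (Real.exp (-((μ.re - π / 4) * travelTime x))) *
        ∫⁻ y in Ioo 0 (2 * π), ‖g ((y : ℝ) : Torus)‖ₑ ^ 2 := by
    refine le_trans ?_ (mul_le_mul_right (lintegral_mono_set (Ioo_subset_Ioo_left hx.1.le)) _)
    rw [← lintegral_const_mul _ (by fun_prop)]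
    refine setLIntegral_mono' measurableSet_Ioo fun y hy => ?_
    have h1 := strictMonoOn_travelTime hx ⟨hx.1.trans hy.1, hy.2⟩ hy.1
    gcongr
  -- The Schur estimate is for the integrand multiplied by the constant `flowExp μ x`; this constant
  -- is nonzero and is divided out at the end.
  have h := (sq_lintegral_kernel_le hμ hg hx).trans_lt
    (ENNReal.mul_lt_top ENNReal.ofReal_lt_top
      (hle.trans_lt (ENNReal.mul_lt_top ENNReal.ofReal_lt_top hfin)))
  have h2 : IntegrableOn (fun y : ℝ => flowExp μ x * (g (y : Torus) / (flowExp μ y * weight y)))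
      (Ioo x (2 * π)) :=
    ⟨(hm.const_mul _).aestronglyMeasurable, (ENNReal.pow_lt_top_iff.1 h).resolve_right (by simp)⟩
  exact (integrable_const_mul_iff (flowExp_ne_zero μ x).isUnit _).1 h2

/-- The equation `weight * f' = μ f + g` has a solution with `‖f‖ ≤ ‖g‖ / (re μ - π / 4)`. -/
lemma exists_isWeightedDeriv_smul_add {μ : ℂ} (hμ : π / 4 < μ.re) (g : L2) :
    ∃ f : L2, IsWeightedDeriv f (μ • f + g) ∧ ‖f‖ ≤ 1 / (μ.re - π / 4) * ‖g‖ := by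
  have hk : 0 < μ.re - π / 4 := sub_pos.2 hμ
  have hg := measurable_comp_coe g
  -- Variation of constants: the solution is `flowExp μ x` times the integral of `m` over `(x, 2π)`.
  -- The sign of `m` compensates for differentiating in the lower limit.
  set m : ℝ → ℂ := fun y => -(g (y : Torus) / (flowExp μ y * weight y)) with hm
  have hG := hasWeakDerivOn_integral_Ioo Real.two_pi_pos (m := m)
    fun x hx => (integrableOn_div_flowExp hμ g hx).neg
  have hF := hG.contDiffOn_mul isOpen_Ioo (contDiffOn_flowExp μ)
  have hle : ∫⁻ x in Ioo 0 (2 * π), ‖flowExp μ x * ∫ y in Ioo x (2 * π), m y‖ₑ ^ 2 ≤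
      ENNReal.ofReal (1 / (μ.re - π / 4)) ^ 2 * ‖g‖ₑ ^ 2 := by
    rw [enorm_sq_eq]
    refine le_trans (lintegral_mono fun x => ?_) (lintegral_sq_lintegral_kernel_le hμ hg)
    rw [← integral_const_mul]
    gcongr
    refine (enorm_integral_le_lintegral_enorm _).trans_eq ?_
    simp [hm]
  have hmem : MemLp (fun x => flowExp μ x * ∫ y in Ioo x (2 * π), m y) 2
      (volume.restrict (Ioo 0 (2 * π))) := by
    refine ⟨hF.1.aestronglyMeasurable, ?_⟩
    have := hle.trans_lt (ENNReal.mul_lt_top (ENNReal.pow_lt_top ENNReal.ofReal_lt_top)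
      (ENNReal.pow_lt_top enorm_lt_top))
    rw [← eLpNorm_two_sq] at this
    exact (ENNReal.pow_lt_top_iff.1 this).resolve_right (by simp)
  obtain ⟨f, hf⟩ := exists_L2_of_memLp hmem
  refine ⟨f, isWeightedDeriv_of_ae hF hf ?_, ?_⟩
  · filter_upwards [hf, ae_coe (Lp.coeFn_add (μ • f) g), ae_coe (Lp.coeFn_smul μ f),
      ae_restrict_mem measurableSet_Ioo] with x h1 h2 h3 hx
    have hw := weight_ofReal_ne_zero hx
    have hφ := flowExp_ne_zero μ x
    rw [h2, Pi.add_apply, h3, Pi.smul_apply, ← h1, deriv_flowExp μ hx, hm, smul_eq_mul]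
    field_simp
    ring
  · have h1 : ‖f‖ₑ ^ 2 ≤ (ENNReal.ofReal (1 / (μ.re - π / 4)) * ‖g‖ₑ) ^ 2 := by
      rw [enorm_sq_eq, mul_pow]
      refine le_trans (lintegral_congr_ae ?_).le hle
      filter_upwards [hf] with x hx
      rw [hx]
    have h2 := (ENNReal.pow_le_pow_left_iff two_ne_zero).1 h1
    rw [← ofReal_norm, ← ofReal_norm, ← ENNReal.ofReal_mul (by positivity)] at h2
    exact (ENNReal.ofReal_le_ofReal_iff (by positivity)).1 h2

/-- Near `2π` the square of the modulus is a power at least one of `x / (2π - x)`, so it dominates a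
multiple of the non-integrable function `1 / (2π - x)`. -/
lemma not_memLp_flowExp {μ : ℂ} (hμ : π / 4 < μ.re) :
    ¬ MemLp (flowExp μ) 2 (volume.restrict (Ioo 0 (2 * π))) := by
  intro h
  have h1 := (memLp_two_iff_integrable_sq_norm h.1).1 h
  have h2 : IntegrableOn (fun x => ‖flowExp μ x‖ ^ 2) (Ioo π (2 * π)) :=
    IntegrableOn.mono_set h1 (Ioo_subset_Ioo_left Real.pi_pos.le)
  have h3 : IntegrableOn (fun x => (x - 2 * π)⁻¹) (Ioo π (2 * π)) := by
    refine (h2.const_mul (1 / π)).mono' (by fun_prop) ?_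
    filter_upwards [ae_restrict_mem measurableSet_Ioo] with x hx
    have hx0 : x ∈ Ioo 0 (2 * π) := ⟨Real.pi_pos.trans hx.1, hx.2⟩
    have hp : 0 < 2 * π - x := sub_pos.2 hx.2
    have hr : 1 ≤ x / (2 * π - x) := by
      rw [le_div_iff₀ hp]
      linarith [hx.1]
    have hc : 1 ≤ 2 * (2 * μ.re) / π := by
      rw [le_div_iff₀ Real.pi_pos]
      linarith
    rw [norm_flowExp, ← Real.exp_nat_mul, Nat.cast_ofNat, ← mul_assoc, exp_travelTime hx0,
      norm_inv, Real.norm_eq_abs, abs_sub_comm, abs_of_pos hp]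
    calc (2 * π - x)⁻¹ = 1 / π * (π / (2 * π - x)) := by field_simp
      _ ≤ 1 / π * (x / (2 * π - x)) := by gcongr; exact hx.1.le
      _ ≤ _ := by
        gcongr
        exact Real.self_le_rpow_of_one_le hr hc
  have h4 : IntervalIntegrable (fun x => (x - 2 * π)⁻¹) volume π (2 * π) := by
    rwa [intervalIntegrable_iff_integrableOn_Ioo_of_le (by linarith [Real.pi_pos])]
  rcases intervalIntegrable_sub_inv_iff.1 h4 with h5 | h5
  · linarith [Real.pi_pos]
  · exact h5 right_mem_uIcc

/-- Multiplication by the integrating factor `flowExp (-μ)` gives a function with zero weak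
derivative, so `f` is a multiple of `flowExp μ`, which is not square integrable. -/
lemma eq_zero_of_isWeightedDeriv_smul {μ : ℂ} (hμ : π / 4 < μ.re) {f : L2}
    (h : IsWeightedDeriv f (μ • f)) : f = 0 := by
  obtain ⟨u, hu, e⟩ := h
  have h1 := hu.contDiffOn_mul isOpen_Ioo (contDiffOn_flowExp (-μ))
  have h2 : (fun x : ℝ => flowExp (-μ) x * u x + deriv (flowExp (-μ)) x * f (x : Torus))
      =ᵐ[volume.restrict (Ioo 0 (2 * π))] fun _ => 0 := by
    filter_upwards [e, ae_coe (Lp.coeFn_smul μ f), ae_restrict_mem measurableSet_Ioo]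
      with x h1 h2 hx
    have hw := weight_ofReal_ne_zero hx
    rw [h2, Pi.smul_apply, smul_eq_mul, cStar_sq_sub_two_mul_etaStar hx] at h1
    rw [deriv_flowExp _ hx]
    field_simp
    linear_combination -(flowExp (-μ) x) * h1
  obtain ⟨c, hc⟩ := (h1.congr_deriv isOpen_Ioo h2).ae_eq_const Real.two_pi_pos
  have hc' : ∀ᵐ x : ℝ ∂volume.restrict (Ioo 0 (2 * π)), f (x : Torus) = c * flowExp μ x := by
    filter_upwards [(ae_restrict_iff' measurableSet_Ioo).2 hc] with x hx
    rw [← hx, mul_right_comm, flowExp_neg_mul, one_mul]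
  by_cases h0 : c = 0
  · refine L2_ext_of_ae ?_
    filter_upwards [hc', ae_coe (Lp.coeFn_zero ℂ 2 (volume : Measure Torus))] with x hx hz
    rw [hx, hz, h0, zero_mul]
    rfl
  · refine absurd ?_ (not_memLp_flowExp hμ)
    refine ((memLp_comp_coe f).const_mul c⁻¹).ae_eq ?_
    filter_upwards [hc'] with x hx
    rw [hx, inv_mul_cancel_left₀ h0]

/-! ### The rank-one term and the resolvent of the full operator -/

/-- The constant functions in `L²(𝕋)`. -/
abbrev const : ℂ →ₗ[ℂ] L2 := Lp.constₗ 2 (volume : Measure Torus) ℂ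

lemma const_coe (c : ℂ) :
    ∀ᵐ x : ℝ ∂volume.restrict (Ioo 0 (2 * π)), c = const c (x : Torus) := by
  filter_upwards [ae_coe (Lp.coeFn_const (p := 2) (μ := (volume : Measure Torus)) c)] with x hx
  exact hx.symm

lemma isWeightedDeriv_const (c : ℂ) : IsWeightedDeriv (const c) 0 := by
  refine isWeightedDeriv_of_ae (hasWeakDerivOn_const c _) (const_coe c) ?_
  filter_upwards [ae_coe (Lp.coeFn_zero ℂ 2 (volume : Measure Torus))] with x hx
  rw [hx, mul_zero]
  rfl

lemma integral_etaStarSlope : ∫ x in Ioo 0 (2 * π), etaStarSlope x = 0 := by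
  rw [setIntegral_congr_fun measurableSet_Ioo fun x hx => etaStarSlope_eq hx,
    ← integral_Ioc_eq_integral_Ioo, ← intervalIntegral.integral_of_le Real.two_pi_pos.le]
  simp
  ring

lemma slopeIntegral_const (c : ℂ) : slopeIntegral (const c) = 0 := by
  change ∫ x in Ioo 0 (2 * π), (etaStarSlope x : ℂ) * const c (x : Torus) = 0
  rw [← integral_congr_ae (f := fun x => (etaStarSlope x : ℂ) * c), integral_mul_const]
  · rw [show ∫ x in Ioo 0 (2 * π), (etaStarSlope x : ℂ) = ((∫ x in Ioo 0 (2 * π), etaStarSlope x :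
      ℝ) : ℂ) from integral_ofReal, integral_etaStarSlope, Complex.ofReal_zero, zero_mul]
  · filter_upwards [const_coe c] with x hx
    rw [← hx]

lemma exists_norm_slopeIntegral_le : ∃ C : ℝ, 0 ≤ C ∧ ∀ f : L2, ‖slopeIntegral f‖ ≤ C * ‖f‖ := by
  set M := ∫⁻ x in Ioo 0 (2 * π), ‖(etaStarSlope x : ℂ)‖ₑ ^ 2 with hM
  have hmeas : Measurable fun x => (etaStarSlope x : ℂ) :=
    Complex.measurable_ofReal.comp (measurable_deriv _)
  have hMfin : M < ⊤ := by
    refine (setLIntegral_mono' (g := fun _ => ENNReal.ofReal (π / 4) ^ 2) measurableSet_Ioo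
      fun x hx => ?_).trans_lt ?_
    · rw [← ofReal_norm, etaStarSlope_eq hx, Complex.norm_real]
      gcongr
      rw [Real.norm_eq_abs, abs_le]
      constructor <;> linarith [hx.1, hx.2]
    · rw [setLIntegral_const]
      exact ENNReal.mul_lt_top (ENNReal.pow_lt_top ENNReal.ofReal_lt_top) measure_Ioo_lt_top
  refine ⟨√M.toReal, by positivity, fun f => ?_⟩
  have h1 : ‖slopeIntegral f‖ₑ ^ 2 ≤ M * ‖f‖ₑ ^ 2 := by
    rw [enorm_sq_eq]
    refine le_trans ?_ (ENNReal.sq_lintegral_mul_le _ hmeas.enorm.aemeasurable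
      (measurable_comp_coe f).enorm.aemeasurable)
    gcongr
    refine (enorm_integral_le_lintegral_enorm _).trans_eq ?_
    simp only [enorm_mul]
  have h2 : ‖slopeIntegral f‖ ^ 2 ≤ M.toReal * ‖f‖ ^ 2 := by
    have := ENNReal.toReal_mono (ENNReal.mul_lt_top hMfin
      (ENNReal.pow_lt_top enorm_lt_top)).ne h1
    simpa using this
  refine abs_le_of_sq_le_sq' ?_ (by positivity) |>.2
  rwa [mul_pow, Real.sq_sqrt ENNReal.toReal_nonneg]

/-- By uniqueness of the weighted derivative, the chosen value in `weightedDeriv` can be replaced by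
any known one. -/
lemma exists_truncatedOperator_eq {f g : L2} (h : IsWeightedDeriv f g) :
    ∃ hf : f ∈ truncatedOperator.domain, truncatedOperator ⟨f, hf⟩ =
      g - const (((1 / π : ℝ) : ℂ) * slopeIntegral f) := by
  refine ⟨⟨g, h⟩, ?_⟩
  have e : weightedDeriv ⟨f, ⟨g, h⟩⟩ = g := (weightedDeriv_spec ⟨f, ⟨g, h⟩⟩).unique h
  have e2 : const (((1 / π : ℝ) : ℂ) * slopeIntegral f) =
      ((1 / π : ℝ) : ℂ) • const (slopeIntegral f) := map_smul const _ _
  rw [e2]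
  conv_rhs => rw [← e]
  rfl

lemma mem_unboundedResolventSet_of_lt_re {μ : ℂ} (hμ : π / 4 < μ.re) :
    μ ∈ unboundedResolventSet truncatedOperator := by
  have hμ0 : μ ≠ 0 := by
    rintro rfl
    simp only [Complex.zero_re] at hμ
    linarith [Real.pi_pos]
  obtain ⟨C, hC0, hC⟩ := exists_norm_slopeIntegral_le
  obtain ⟨N, hN0, hN⟩ : ∃ N : ℝ, 0 ≤ N ∧ ∀ c : ℂ, ‖const c‖ ≤ ‖c‖ * N :=
    ⟨_, by positivity, fun c => Lp.norm_const_le (p := 2) (μ := (volume : Measure Torus)) (c := c)⟩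
  have hk : 0 < μ.re - π / 4 := sub_pos.2 hμ
  set K := 1 / (μ.re - π / 4)
  have hK : 0 ≤ K := by positivity
  refine mem_unboundedResolventSet_of_exists_bound
    (K + 1 / π * (C * K) / ‖μ‖ * N) (fun x hx => ?_) fun y => ?_
  · obtain ⟨g, hg⟩ : ∃ g, IsWeightedDeriv (x : L2) g := x.2
    obtain ⟨h1, h2⟩ := exists_truncatedOperator_eq hg
    rw [Subtype.coe_eta, hx] at h2
    set c : ℂ := ((1 / π : ℝ) : ℂ) * slopeIntegral x with hc
    -- The constant is absorbed: `x + c / μ` solves the equation without the rank-one term, hence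
    -- vanishes. Then `x` is constant, so `c = 0`, so `x = 0`.
    have h3 : g = μ • ((x : L2) + const (c / μ)) := by
      rw [smul_add, ← map_smul, smul_eq_mul, mul_div_cancel₀ _ hμ0, h2, sub_add_cancel]
    have h4 := hg.add (isWeightedDeriv_const (c / μ))
    rw [add_zero, h3] at h4
    have h5 : (x : L2) = const (-(c / μ)) := by
      rw [map_neg]
      exact eq_neg_of_add_eq_zero_left (eq_zero_of_isWeightedDeriv_smul hμ h4)
    have h6 : c = 0 := by rw [hc, h5, slopeIntegral_const, mul_zero]
    rw [h5, h6, zero_div, neg_zero, map_zero]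
  · obtain ⟨f, hf, hb⟩ := exists_isWeightedDeriv_smul_add hμ y
    set c : ℂ := ((1 / π : ℝ) : ℂ) * slopeIntegral f with hc
    -- The shift by `-c / μ` changes neither the weighted derivative nor the slope integral, while
    -- `-μ` times the shift equals `c` and cancels the rank-one term.
    have h1 := hf.add (isWeightedDeriv_const (-(c / μ)))
    obtain ⟨h2, h3⟩ := exists_truncatedOperator_eq h1
    refine ⟨⟨_, h2⟩, ?_, ?_⟩
    · have e1 : μ • const (-(c / μ)) = - const c := by
        rw [← map_smul, smul_eq_mul, mul_neg, mul_div_cancel₀ _ hμ0, map_neg]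
      rw [h3, map_add slopeIntegral, slopeIntegral_const, add_zero, add_zero, ← hc]
      change μ • f + y - const c - μ • (f + const (-(c / μ))) = y
      rw [smul_add, e1]
      abel
    · have hs : ‖slopeIntegral f‖ ≤ C * (K * ‖y‖) := (hC f).trans (by gcongr)
      have hcn : ‖-(c / μ)‖ ≤ 1 / π * (C * (K * ‖y‖)) / ‖μ‖ := by
        rw [norm_neg, norm_div, hc, norm_mul, Complex.norm_real,
          Real.norm_of_nonneg (by positivity)]
        gcongr
      calc ‖f + const (-(c / μ))‖ ≤ ‖f‖ + ‖const (-(c / μ))‖ := norm_add_le _ _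
        _ ≤ K * ‖y‖ + 1 / π * (C * (K * ‖y‖)) / ‖μ‖ * N := by
          gcongr
          exact (hN _).trans (by gcongr)
        _ = _ := by ring

end PeakedWave
-- Eigenfunctions inside the strip
namespace PeakedWave

/-- The square of the modulus is `(x / (2π - x)) ^ q` with `0 ≤ q < 1`: bounded near `0` and
integrable near `2π`. -/
lemma memLp_flowExp {μ : ℂ} (h0 : 0 < μ.re) (h1 : μ.re < π / 4) :
    MemLp (flowExp μ) 2 (volume.restrict (Ioo 0 (2 * π))) := by
  rw [memLp_two_iff_integrable_sq_norm (measurable_flowExp μ).aestronglyMeasurable]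
  set q := 2 * (2 * μ.re) / π with hq
  have hq0 : 0 ≤ q := by positivity
  have hq1 : q < 1 := by
    rw [hq, div_lt_one Real.pi_pos]
    linarith
  have h2 : IntervalIntegrable (fun x : ℝ => (2 * π - x) ^ (-q)) volume (2 * π - 0)
      (2 * π - 2 * π) :=
    (intervalIntegral.intervalIntegrable_rpow' (by linarith)).comp_sub_left (2 * π)
  rw [sub_zero, sub_self] at h2
  have h3 := (intervalIntegrable_iff_integrableOn_Ioo_of_le Real.two_pi_pos.le).1 h2.symm
  refine (Integrable.const_mul h3 ((2 * π) ^ q)).mono'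
    ((measurable_flowExp μ).norm.pow_const 2).aestronglyMeasurable ?_
  filter_upwards [ae_restrict_mem measurableSet_Ioo] with x hx
  have hp : 0 < 2 * π - x := sub_pos.2 hx.2
  rw [Real.norm_of_nonneg (by positivity), norm_flowExp, ← Real.exp_nat_mul, Nat.cast_ofNat,
    ← mul_assoc, exp_travelTime hx, ← hq, Real.div_rpow hx.1.le hp.le, Real.rpow_neg hp.le,
    div_eq_mul_inv]
  gcongr
  · exact hx.1.le
  · exact hx.2.le

lemma exists_eigenvector {μ : ℂ} (h0 : 0 < μ.re) (h1 : μ.re < π / 4) :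
    ∃ x : truncatedOperator.domain, (x : L2) ≠ 0 ∧ truncatedOperator x = μ • (x : L2) := by
  have hμ0 : μ ≠ 0 := by
    rintro rfl
    simp at h0
  obtain ⟨f, hf⟩ := exists_L2_of_memLp (memLp_flowExp h0 h1)
  have hd : IsWeightedDeriv f (μ • f) := by
    refine isWeightedDeriv_of_ae (F := flowExp μ) (u := fun x => deriv (flowExp μ) x) ?_ hf ?_
    · simpa using (hasWeakDerivOn_const 1 (Ioo 0 (2 * π))).contDiffOn_mul isOpen_Ioo
        (contDiffOn_flowExp μ)
    · filter_upwards [hf, ae_coe (Lp.coeFn_smul μ f), ae_restrict_mem measurableSet_Ioo]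
        with x h2 h3 hx
      have hw := weight_ofReal_ne_zero hx
      rw [h3, Pi.smul_apply, ← h2, deriv_flowExp μ hx, smul_eq_mul]
      field_simp
  have hf0 : f ≠ 0 := by
    rintro rfl
    have h2 : ∀ᵐ x : ℝ ∂volume.restrict (Ioo 0 (2 * π)), False := by
      filter_upwards [hf, ae_coe (Lp.coeFn_zero ℂ 2 (volume : Measure Torus))] with x h2 h3
      exact flowExp_ne_zero μ x (h2.trans h3)
    rw [Filter.eventually_false_iff_eq_bot, ae_eq_bot, Measure.restrict_eq_zero,
      Real.volume_Ioo, ENNReal.ofReal_eq_zero] at h2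
    linarith [Real.pi_pos]
  set c : ℂ := ((1 / π : ℝ) : ℂ) * slopeIntegral f with hc
  obtain ⟨h2, h3⟩ := exists_truncatedOperator_eq (hd.add (isWeightedDeriv_const (-(c / μ))))
  refine ⟨⟨_, h2⟩, fun h => hf0 ?_, ?_⟩
  -- If the shifted function vanished, `f` would be constant, so its weighted derivative `μ f` would
  -- be zero.
  · have h4 : f = const (c / μ) := by
      rw [← sub_eq_zero, sub_eq_add_neg, ← map_neg]
      exact h
    have h5 : μ • f = 0 := hd.unique (by rw [h4]; exact isWeightedDeriv_const _)
    exact (smul_eq_zero.1 h5).resolve_left hμ0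
  · have e1 : μ • const (-(c / μ)) = - const c := by
      rw [← map_smul, smul_eq_mul, mul_neg, mul_div_cancel₀ _ hμ0, map_neg]
    rw [h3, map_add slopeIntegral, slopeIntegral_const, add_zero, add_zero, ← hc]
    change μ • f - const c = μ • (f + const (-(c / μ)))
    rw [smul_add, e1, sub_eq_add_neg]

/-! ### Reflection symmetry of the spectrum -/

/-- The reflection `f ↦ f(-·)` of `L²(𝕋)`. -/
def reflection : L2 →ₗᵢ[ℂ] L2 :=
  Lp.compMeasurePreservingₗᵢ ℂ (Neg.neg : Torus → Torus) (Measure.measurePreserving_neg volume)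

lemma measurePreserving_two_pi_sub : MeasurePreserving (fun x : ℝ => 2 * π - x)
    (volume.restrict (Ioo 0 (2 * π))) (volume.restrict (Ioo 0 (2 * π))) := by
  have h := (Measure.measurePreserving_sub_left (volume : Measure ℝ) (2 * π)).restrict_preimage
    (measurableSet_Ioo (a := 0) (b := 2 * π))
  rwa [preimage_const_sub_Ioo, sub_zero, sub_self] at h

lemma reflection_coe (f : L2) : ∀ᵐ x : ℝ ∂volume.restrict (Ioo 0 (2 * π)),
    f ((2 * π - x : ℝ) : Torus) = reflection f (x : Torus) := by
  filter_upwards [ae_coe (Lp.coeFn_compMeasurePreserving f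
    (Measure.measurePreserving_neg (volume : Measure Torus)))] with x hx
  have h2 : ((2 * π - x : ℝ) : Torus) = -(x : Torus) := by
    rw [AddCircle.coe_sub, AddCircle.coe_period, zero_sub]
  rw [h2]
  exact hx.symm

lemma reflection_reflection (f : L2) : reflection (reflection f) = f := by
  refine L2_ext_of_ae ?_
  filter_upwards [reflection_coe (reflection f),
    measurePreserving_two_pi_sub.quasiMeasurePreserving.ae (reflection_coe f)] with x h1 h2
  rw [← h1, ← h2, sub_sub_cancel]

lemma reflection_const (c : ℂ) : reflection (const c) = const c := by
  refine L2_ext_of_ae ?_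
  filter_upwards [reflection_coe (const c), const_coe c,
    measurePreserving_two_pi_sub.quasiMeasurePreserving.ae (const_coe c)] with x h1 h2 h3
  rw [← h1, ← h2, ← h3]

lemma slopeIntegral_reflection (f : L2) : slopeIntegral (reflection f) = - slopeIntegral f := by
  change ∫ x in Ioo 0 (2 * π), (etaStarSlope x : ℂ) * reflection f (x : Torus) =
    - ∫ x in Ioo 0 (2 * π), (etaStarSlope x : ℂ) * f (x : Torus)
  rw [← measurePreserving_two_pi_sub.integral_comp
    (Homeomorph.subLeft (2 * π)).measurableEmbedding, ← integral_neg]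
  refine integral_congr_ae ?_
  filter_upwards [measurePreserving_two_pi_sub.quasiMeasurePreserving.ae (reflection_coe f),
    ae_restrict_mem measurableSet_Ioo] with x h1 hx
  have hx' : 2 * π - x ∈ Ioo 0 (2 * π) := ⟨by linarith [hx.2], by linarith [hx.1]⟩
  rw [← h1, sub_sub_cancel, etaStarSlope_eq hx, etaStarSlope_eq hx', ← neg_mul, ← Complex.ofReal_neg]
  congr 2
  ring

lemma IsWeightedDeriv.reflection {f g : L2} (h : IsWeightedDeriv f g) :
    IsWeightedDeriv (reflection f) (-(PeakedWave.reflection g)) := by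
  obtain ⟨u, hu, e⟩ := h
  refine isWeightedDeriv_of_ae hu.comp_sub_left (reflection_coe f) ?_
  filter_upwards [reflection_coe g, measurePreserving_two_pi_sub.quasiMeasurePreserving.ae e,
    ae_coe (Lp.coeFn_neg (PeakedWave.reflection g)), ae_restrict_mem measurableSet_Ioo]
    with x h1 h2 h3 hx
  have hx' : 2 * π - x ∈ Ioo 0 (2 * π) := ⟨by linarith [hx.2], by linarith [hx.1]⟩
  have hw : weight (2 * π - x) = weight x := by
    unfold weight
    ring
  rw [h3, Pi.neg_apply, ← h1, h2, cStar_sq_sub_two_mul_etaStar hx', hw, mul_neg]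

/-- The coefficient `w` is even, while the derivative and the slope `η_*'` are odd, so both terms of
the operator change sign under reflection. -/
lemma neg_mem_unboundedResolventSet_truncatedOperator {μ : ℂ}
    (hμ : μ ∈ unboundedResolventSet truncatedOperator) :
    -μ ∈ unboundedResolventSet truncatedOperator := by
  refine neg_mem_unboundedResolventSet reflection.toContinuousLinearMap reflection_reflection
    (fun x => ?_) hμ
  obtain ⟨g, hg⟩ : ∃ g, IsWeightedDeriv (x : L2) g := x.2
  obtain ⟨h1, h2⟩ := exists_truncatedOperator_eq hg
  obtain ⟨h3, h4⟩ := exists_truncatedOperator_eq hg.reflection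
  refine ⟨h3, h4.trans ?_⟩
  rw [Subtype.coe_eta] at h2
  rw [h2, slopeIntegral_reflection, mul_neg, map_neg]
  change _ = -reflection _
  rw [map_sub, reflection_const]
  abel

end PeakedWave
end

theorem mainTheorem3 :
    unboundedSpectrum PeakedWave.truncatedOperator =
      {μ : ℂ | -(Real.pi / 4) ≤ μ.re ∧ μ.re ≤ Real.pi / 4} := by
  have hpos : ∀ μ : ℂ, 0 ≤ μ.re →
      (μ ∈ unboundedSpectrum PeakedWave.truncatedOperator ↔ μ.re ≤ Real.pi / 4) := by
    intro μ hμ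
    refine ⟨fun h => ?_, fun h => ?_⟩
    · by_contra h1
      exact h (PeakedWave.mem_unboundedResolventSet_of_lt_re (not_le.1 h1))
    -- The closure of the open half-strip supplies the line `Re μ = π/4` and the imaginary axis,
    -- including `μ = 0`, where division by `μ` is impossible.
    · refine mem_unboundedSpectrum_of_mem_closure (S := Ioo 0 (Real.pi / 4) ×ℂ univ)
        (fun z hz => PeakedWave.exists_eigenvector hz.1.1 hz.1.2) ?_
      rw [Complex.closure_reProdIm, closure_Ioo (by positivity), closure_univ]
      exact ⟨⟨hμ, h⟩, mem_univ _⟩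
  have hneg : ∀ μ : ℂ, -μ ∈ unboundedSpectrum PeakedWave.truncatedOperator ↔
      μ ∈ unboundedSpectrum PeakedWave.truncatedOperator := fun μ =>
    not_congr ⟨fun h => by
      simpa using PeakedWave.neg_mem_unboundedResolventSet_truncatedOperator h,
      PeakedWave.neg_mem_unboundedResolventSet_truncatedOperator⟩
  ext μ
  rcases le_total 0 μ.re with h | h
  · rw [hpos μ h, mem_ofPred_eq]
    exact ⟨fun h1 => ⟨by linarith [Real.pi_pos], h1⟩, fun h1 => h1.2⟩
  · rw [← hneg, hpos (-μ) (by simpa using h), Complex.neg_re, mem_ofPred_eq]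
    exact ⟨fun h1 => ⟨by linarith, by linarith [Real.pi_pos]⟩, fun h1 => by linarith [h1.1]⟩
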